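/- Let $(A,\mathfrak m)$ be a Noetherian local ring, let $I$ be an ideal of $A$, and let $M$ be a finitely generated $A$-module with $\operatorname{grade}(I,M)=g>0$. Here $\operatorname{grade}(J,E)$ is the supremum of the lengths of the $E$-regular sequences contained in $J$, with the convention $\operatorname{grade}(J,E)=\infty$ if $JE=E$. For an ideal $J$ of $A$ write $G_J(A)=\bigoplus_{n\ge 0}J^n/J^{n+1}$, $G_J(A)_+=\bigoplus_{n\ge 1}J^n/J^{n+1}$ and $G_J(M)=\bigoplus_{n\ge 0}J^nM/J^{n+1}M$. Let $\mathcal R(I)=\bigoplus_{n\ge 0}I^nt^n$ be the Rees ring and $\mathcal R(I)_+=\bigoplus_{n\ge 1}I^nt^n$. Let $L^I(M)=\bigoplus_{n\ge 0}M/I^{n+1}M$, a graded $\mathcal R(I)$-module via $(at^j)\cdot(m+I^{k+1}M)=am+I^{j+k+1}M$ for $a\in I^j$, and let $H^i(L^I(M))_n$ be the degree $n$ component $(n\in\mathbb Z)$ of the local cohomology module $H^i_{\mathcal R(I)_+}(L^I(M))$, computed by the graded Čech complex on $x_1t,\dots,x_rt$ for any finite generating set $x_1,\dots,x_r$ of $I$.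 Let $\xi_I(M)$ be the minimum of $g$ and of all integers $i$ with $0\le i\le g-1$ such that $H^i(L^I(M))_{-1}\ne 0$ or $H^i(L^I(M))_j\neq 0$ for infinitely many $j<0$, and set $$\operatorname{amp}_I(M)=\sup\{\,|n| : n\in\mathbb Z,\ H^i(L^I(M))_{n-1}\ne 0\text{ for some } 0\le i\le \xi_I(M)-1\,\},$$ where $\sup\emptyset=0$. Then exactly one of the following holds: (i) $\operatorname{grade}(G_{I^n}(A)_+,G_{I^n}(M))=1$ for all integers $n>\operatorname{amp}_I(M)$; (ii) $\operatorname{grade}(G_{I^n}(A)_+,G_{I^n}(M))\ge 2$ for all integers $n>\operatorname{amp}_I(M)$. -/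

import Mathlib

open Polynomial

noncomputable section

universe u v

/-! ### Grade -/

/-- `grade(J, E)`: the supremum of the lengths of the `E`-regular sequences contained in `J`.
It is `∞` when `JE = E` for a finitely generated `E`, since the sequences are only required to be
weakly regular (for `JE ≠ E`, weakly regular sequences in `J` are regular). -/
def moduleGrade {R : Type*} [CommRing R] (J : Ideal R) (E : Type*) [AddCommGroup E] [Module R E] :
    ℕ∞ :=
  ⨆ (rs : List R) (_ : (∀ r ∈ rs, r ∈ J) ∧ RingTheory.Sequence.IsWeaklyRegular E rs),
    (rs.length : ℕ∞)

/-! ### The associated graded ring, the associated graded module, and `L^I(M)` -/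

section AssociatedGraded

variable {A : Type u} [CommRing A] (I : Ideal A) (M : Type v) [AddCommGroup M] [Module A M]

/-- The Rees module `R(I, M) = ⨁_{n ≥ 0} IⁿM tⁿ`, a module over the Rees ring `R(I)`. -/
abbrev reesModule : Submodule (reesAlgebra I) (PolynomialModule A M) :=
  (I.stableFiltration (⊤ : Submodule A M)).submodule

theorem mem_reesModule_iff (f : PolynomialModule A M) :
    f ∈ reesModule I M ↔ ∀ n, f.coeff n ∈ I ^ n • (⊤ : Submodule A M) :=
  Iff.rfl

theorem coeff_smul_mem {F : ℕ → Ideal A} {N : ℕ → Submodule A M} {P : ℕ → Submodule A M}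
    (h : ∀ j k, F j • N k ≤ P (j + k)) (r : A[X]) (f : PolynomialModule A M)
    (hr : ∀ n, r.coeff n ∈ F n) (hf : ∀ n, f.coeff n ∈ N n) (n : ℕ) :
    (r • f).coeff n ∈ P n := by
  rw [PolynomialModule.smul_apply]
  refine Submodule.sum_mem _ fun jk hjk => ?_
  rw [← Finset.HasAntidiagonal.mem_antidiagonal.mp hjk]
  exact h _ _ (Submodule.smul_mem_smul (hr _) (hf _))

/-- The ideal `⨁_{n ≥ 0} Iⁿ⁺¹ tⁿ` of the Rees ring `R(I) = ⨁_{n ≥ 0} Iⁿ tⁿ`. -/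
def reesShiftIdeal : Ideal (reesAlgebra I) where
  carrier := {f | ∀ n, (f : A[X]).coeff n ∈ I ^ (n + 1)}
  zero_mem' := fun n => by simp
  add_mem' := fun {f g} hf hg n => by
    simpa using Ideal.add_mem _ (hf n) (hg n)
  smul_mem' := fun r f hf n => by
    simp only [smul_eq_mul, Subalgebra.coe_mul, coeff_mul]
    refine Ideal.sum_mem _ fun jk hjk => ?_
    rw [← Finset.HasAntidiagonal.mem_antidiagonal.mp hjk, add_assoc, pow_add]
    exact Ideal.mul_mem_mul (r.2 _) (hf _)

/-- The `R(I)`-submodule `⨁_{n ≥ 0} Iⁿ⁺¹M tⁿ` of `M[t]`. -/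
def lSubmodule : Submodule (reesAlgebra I) (PolynomialModule A M) where
  carrier := {f | ∀ n, f.coeff n ∈ I ^ (n + 1) • (⊤ : Submodule A M)}
  zero_mem' := fun n => by simp
  add_mem' := fun {f g} hf hg n => by
    simpa using Submodule.add_mem _ (hf n) (hg n)
  smul_mem' := fun r f hf n =>
    coeff_smul_mem M (F := fun n => I ^ n) (N := fun n => I ^ (n + 1) • (⊤ : Submodule A M))
      (P := fun n => I ^ (n + 1) • (⊤ : Submodule A M))
      (fun j k => by rw [← Submodule.mul_smul, ← pow_add, add_assoc]) (r : A[X]) f r.2 hf n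

/-- `L^I(M) = ⨁_{n ≥ 0} M / Iⁿ⁺¹M`, as a module over the Rees ring `R(I)`:
`(a tʲ) • (m + Iᵏ⁺¹M) = a m + Iʲ⁺ᵏ⁺¹M` for `a ∈ Iʲ`. -/
abbrev LModule : Type v := PolynomialModule A M ⧸ lSubmodule I M

/-- The associated graded ring `G_I(A) = ⨁_{n ≥ 0} Iⁿ / Iⁿ⁺¹`, with the multiplication induced
by that of the Rees ring. -/
abbrev assocGradedRing : Type u := reesAlgebra I ⧸ reesShiftIdeal I

/-- The associated graded module `G_I(M) = ⨁_{n ≥ 0} IⁿM / Iⁿ⁺¹M`, as an `R(I)`-submodule of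
`L^I(M) = ⨁_{n ≥ 0} M / Iⁿ⁺¹M`: the image of the Rees module `⨁_{n ≥ 0} IⁿM tⁿ`. -/
abbrev assocGradedModule : Submodule (reesAlgebra I) (LModule I M) :=
  (reesModule I M).map (lSubmodule I M).mkQ

theorem assocGradedModule_isTorsionBySet :
    Module.IsTorsionBySet (reesAlgebra I) (assocGradedModule I M) (reesShiftIdeal I) := by
  rintro ⟨_, f, hf, rfl⟩ ⟨r, hr⟩
  refine Subtype.ext ((Submodule.Quotient.mk_eq_zero (lSubmodule I M) (x := r • f)).2 fun n => ?_)
  exact coeff_smul_mem M (F := fun n => I ^ (n + 1)) (N := fun n => I ^ n • (⊤ : Submodule A M))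
    (P := fun n => I ^ (n + 1) • (⊤ : Submodule A M))
    (fun j k => by rw [← Submodule.mul_smul, ← pow_add, add_right_comm]) (r : A[X]) f hr hf n

/-- `G_I(M)` as a `G_I(A)`-module: `(a + Iʲ⁺¹) • (m + Iᵏ⁺¹M) = a m + Iʲ⁺ᵏ⁺¹M`. -/
instance : Module (assocGradedRing I) (assocGradedModule I M) :=
  (assocGradedModule_isTorsionBySet I M).module

/-- The irrelevant ideal `G_I(A)₊ = ⨁_{n ≥ 1} Iⁿ / Iⁿ⁺¹`, the image of `⨁_{n ≥ 1} Iⁿ tⁿ`. -/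
def irrelevantIdeal : Ideal (assocGradedRing I) :=
  Ideal.map (Ideal.Quotient.mk (reesShiftIdeal I))
    (RingHom.ker (Polynomial.constantCoeff.comp (reesAlgebra I).val.toRingHom))

/-- `grade(G_I(A)₊, G_I(M))`. -/
def gradeAssocGraded : ℕ∞ := moduleGrade (R := assocGradedRing I) (irrelevantIdeal I) (assocGradedModule I M)

end AssociatedGraded

/-! ### Graded local cohomology through the Čech complex -/

section Cech

variable {R : Type*} [CommRing R]

theorem isUnit_algebraMap_end_of_dvd {a b : R} (h : a ∣ b) (E : Type*) [AddCommGroup E]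
    [Module R E] (s : Submonoid.powers a) :
    IsUnit (algebraMap R (Module.End R (LocalizedModule (Submonoid.powers b) E)) s) := by
  obtain ⟨_, k, rfl⟩ := s
  obtain ⟨c, hc⟩ := pow_dvd_pow_of_dvd h k
  have hu := IsLocalizedModule.map_units (LocalizedModule.mkLinearMap (Submonoid.powers b) E)
    (⟨b ^ k, k, rfl⟩ : Submonoid.powers b)
  simp only [hc, map_mul] at hu
  exact ((Commute.isUnit_mul_iff (Commute.map (Commute.all (a ^ k) c)
    (algebraMap R (Module.End R (LocalizedModule (Submonoid.powers b) E))))).1 hu).1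

/-- The canonical map `E_a → E_b` between localizations, for `a ∣ b`. -/
def localizationRes {a b : R} (h : a ∣ b) (E : Type*) [AddCommGroup E] [Module R E] :
    LocalizedModule (Submonoid.powers a) E →ₗ[R] LocalizedModule (Submonoid.powers b) E :=
  LocalizedModule.lift (Submonoid.powers a) (LocalizedModule.mkLinearMap (Submonoid.powers b) E)
    (isUnit_algebraMap_end_of_dvd h E)

variable {m : ℕ} (f : Fin m → R) (E : Type*) [AddCommGroup E] [Module R E]

/-- `f_σ = f_{σ(0)} ⋯ f_{σ(p-1)}` for `σ(0) < ⋯ < σ(p-1)`. -/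
abbrev cechProd {p : ℕ} (σ : Fin p ↪o Fin m) : R := ∏ k, f (σ k)

/-- `σ` with its `j`-th entry left out. -/
abbrev cechFace {p : ℕ} (σ : Fin (p + 1) ↪o Fin m) (j : Fin (p + 1)) : Fin p ↪o Fin m :=
  (Fin.succAboveOrderEmb j).trans σ

theorem cechProd_face_dvd {p : ℕ} (σ : Fin (p + 1) ↪o Fin m) (j : Fin (p + 1)) :
    cechProd f (cechFace σ j) ∣ cechProd f σ :=
  ⟨f (σ j), by
    rw [cechProd, Fin.prod_univ_succAbove _ j, mul_comm]
    rfl⟩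

/-- The `p`-th term `⨁_{i₁ < ⋯ < i_p} E_{f_{i₁} ⋯ f_{i_p}}` of the Čech complex
`0 → E → ⨁_i E_{f_i} → ⨁_{i < j} E_{f_i f_j} → ⋯ → E_{f_1 ⋯ f_m} → 0`. -/
abbrev CechCochain (p : ℕ) : Type _ :=
  ∀ σ : Fin p ↪o Fin m, LocalizedModule (Submonoid.powers (cechProd f σ)) E

/-- The Čech differential: the alternating sum of the canonical maps between localizations. -/
def cechD (p : ℕ) : CechCochain f E p →ₗ[R] CechCochain f E (p + 1) :=
  LinearMap.pi fun σ => ∑ j : Fin (p + 1),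
    (-1 : R) ^ (j : ℕ) • (localizationRes (cechProd_face_dvd f σ j) E ∘ₗ
      LinearMap.proj (cechFace σ j))

/-- The coboundaries in the `p`-th term of the Čech complex. -/
def cechCoboundaries : ∀ p : ℕ, Submodule R (CechCochain f E p)
  | 0 => ⊥
  | p + 1 => LinearMap.range (cechD f E p)

/-- The `p`-th cohomology of the Čech complex. For a Noetherian ring `R` it is the local cohomology
module `H^p_J(E)` with support in the ideal `J = (f_1, …, f_m)`. -/
abbrev CechCohomology (p : ℕ) : Type _ :=
  LinearMap.ker (cechD f E p) ⧸
    (cechCoboundaries f E p).comap (LinearMap.ker (cechD f E p)).subtype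

variable {E}

/-- For a `ℤ`-graded module `E = ⨁ E_n` and a homogeneous `a ∈ R` of degree `p`, the degree `n`
part `{e / a^k : e ∈ E_{n + kp}}` of the localization `E_a`. -/
def localizationDeg (gr : ℤ → AddSubgroup E) (a : R) (p : ℕ) (n : ℤ) :
    AddSubgroup (LocalizedModule (Submonoid.powers a) E) :=
  AddSubgroup.closure {z | ∃ k : ℕ, ∃ e ∈ gr (n + k * p),
    z = LocalizedModule.mk e (⟨a ^ k, k, rfl⟩ : Submonoid.powers a)}

/-- For a `ℤ`-graded module `E = ⨁ E_n` and `f_1, …, f_m` homogeneous of degree `1`, the degree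
`n` part `H^p(E)_n` of the Čech cohomology: the classes of the cocycles that are homogeneous of
degree `n`. -/
def cechCohomologyDeg (gr : ℤ → AddSubgroup E) (p : ℕ) (n : ℤ) :
    AddSubgroup (CechCohomology f E p) :=
  AddSubgroup.map (Submodule.mkQ
      ((cechCoboundaries f E p).comap (LinearMap.ker (cechD f E p)).subtype)).toAddMonoidHom
    (AddSubgroup.comap (LinearMap.ker (cechD f E p)).subtype.toAddMonoidHom
      (AddSubgroup.pi Set.univ fun σ => localizationDeg gr (cechProd f σ) p n))

end Cech

/-! ### The amplitude -/

section Amplitude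

variable {A : Type u} [CommRing A] (I : Ideal A) (M : Type v) [AddCommGroup M] [Module A M]

/-- The degree `d` part of `L^I(M)`: it is `M / I^{d+1}M` for `d ≥ 0`, and `0` for `d < 0`. -/
def lModuleDeg (d : ℤ) : AddSubgroup (LModule I M) :=
  AddSubgroup.map (lSubmodule I M).mkQ.toAddMonoidHom
    { carrier := {f : PolynomialModule A M | ∀ k : ℕ, (k : ℤ) ≠ d → f.coeff k = 0}
      zero_mem' := fun k _ => by simp
      add_mem' := fun {f g} hf hg k hk => by simp [hf k hk, hg k hk]
      neg_mem' := fun {f} hf k hk => neg_eq_zero.2 (hf k hk) }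

variable {I}

/-- The elements `x_1 t, …, x_m t` of degree `1` of the Rees ring, for `x_1, …, x_m ∈ I`. -/
def reesGen {m : ℕ} (x : Fin m → I) (i : Fin m) : reesAlgebra I :=
  ⟨Polynomial.monomial 1 (x i : A), by
    rw [mem_reesAlgebra_iff]
    intro n
    rw [Polynomial.coeff_monomial]
    split_ifs with h
    · subst h
      simp
    · simp⟩

/-- `H^i(L^I(M))_n`, the degree `n` part of the `i`-th local cohomology of `L^I(M)` with support in
`R(I)₊ = (x_1 t, …, x_m t)`, where `x_1, …, x_m` are generators of `I`. -/
def lCohomologyDeg {m : ℕ} (x : Fin m → I) (i : ℕ) (n : ℤ) :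
    AddSubgroup (CechCohomology (reesGen x) (LModule I M) i) :=
  cechCohomologyDeg (reesGen x) (lModuleDeg I M) i n

/-- `ξ_I(M)`: the minimum of `g = grade(I, M)` and of all `0 ≤ i ≤ g - 1` such that
`H^i(L^I(M))_{-1} ≠ 0` or `H^i(L^I(M))_j ≠ 0` for infinitely many `j < 0`. -/
def xiInvariant {m : ℕ} (x : Fin m → I) : ℕ∞ :=
  min (moduleGrade I M) (⨅ (i : ℕ) (_ : (i : ℕ∞) < moduleGrade I M ∧
    (lCohomologyDeg M x i (-1) ≠ ⊥ ∨ {j : ℤ | j < 0 ∧ lCohomologyDeg M x i j ≠ ⊥}.Infinite)),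
      (i : ℕ∞))

/-- The amplitude `amp_I(M)`: the supremum of all `|n|` such that `H^i(L^I(M))_{n-1} ≠ 0` for some
`0 ≤ i ≤ ξ_I(M) - 1` (it is `0` if there are none). -/
def amplitude {m : ℕ} (x : Fin m → I) : ℕ∞ :=
  ⨆ (n : ℤ) (_ : ∃ i : ℕ, (i : ℕ∞) < xiInvariant M x ∧ lCohomologyDeg M x i (n - 1) ≠ ⊥),
    (n.natAbs : ℕ∞)

end Amplitude

end

/-!
Write `g = grade(I, M)`, `ξ = ξ_I(M)`, `L = L^I(M)`. Both alternatives are decided by the number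
`ξ`, which does not depend on `n`: for every `n > amp_I(M)` the grade of `G_{I^n}(A)₊` on
`G_{I^n}(M)` is at least `1`, and it is at least `2` if and only if `ξ ≥ 2`. The alternatives
exclude each other because `amp_I(M)` is finite, so that integers `n > amp_I(M)` exist.

*Veronese degrees.* If `n > amp_I(M)` and `i < ξ`, then `H^i(L)` vanishes in all degrees `nk - 1`,
`k ≥ 0` (`lCohomologyDeg_mul_sub_one_eq_bot`; for `k = 0` this is part of the definition of `ξ`).
The components of `L` in these degrees are the `M / I^{nk}M`, that is, those of `L^{I^n}(M)` up to a
shift. The local cohomology of `L` is computed by the Čech complex, and `x_1, …, x_m` may be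
replaced by their powers in cocycle conditions, so `H^0` and `H^1` can be written out as statements
on elements of `M` (`mem_of_lCohomologyDeg_zero`, `exists_of_lCohomologyDeg_one`). Now
`H^0(L)_j = 0` for `j < 0`, whence `ξ ≥ 1`. The vanishing of `H^0` in degrees `nk - 1` gives
`grade ≥ 1`, and, if `ξ ≥ 2`, the vanishing of `H^0` and `H^1` in these degrees shows
that `H^0` and `H^1` of `G_{I^n}(M)` vanish, which gives `grade ≥ 2`
(`two_le_moduleGrade_of_forall`).

*Conversely*, suppose that `grade(G_{I^n}(A)₊, G_{I^n}(M)) ≥ 2`, and put `J = I^n`, `y_i = x_i^n`.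
Then compatible systems over `G_J(M)` are solvable, and successive approximation lifts this to `M`:
if `y_j^N u_i - y_i^N u_j ∈ J^{r+N}M` for all `i, j`, then there is a `v` with
`u_i - y_i^N v ∈ J^r M` (`exists_of_two_le_gradeAssocGraded`). This has two consequences. A cocycle
of negative degree of `L` is moved by a power of `x_l t` into a degree where the lemma applies,
so `H^1(L)_d = 0` for all `d < 0`. And if `y_j u_i = y_i u_j` exactly, the system is solvable
modulo all powers of `J`, hence solvable by Krull's intersection theorem, so that `g ≥ 2`. Together,
`ξ ≥ 2` (`one_lt_xiInvariant_of_two_le`).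

*Finiteness of the amplitude* (`amplitude_lt_top`). Only finitely many `i` matter, and for `i < ξ`
the definition of `ξ` bounds the degrees below. For the degrees above, use the exact sequence
`0 → ⨁ I^{n+1}M → M[t] → L → 0` over the Rees ring. Serre vanishing
(`eventuallyCechVanishes_of_support`) applies to the finitely generated kernel. In degrees `≥ 0` and
for `i < g` the cohomology of `M[t]` vanishes (`cechVanishes_polyDeg`): multiplication by `t`
identifies the actions of `x_l` and of `x_l t` there, so each cohomology class is killed by a power
of every `x_l`, and an `M`-regular sequence in `I` of length greater than `i` excludes
nonzero classes of this kind.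
-/

noncomputable section

universe w

/-! ### Fractions in the localization at one element -/

section Fractions

variable {R : Type*} [CommRing R] {E : Type*} [AddCommGroup E] [Module R E]

/-- The fraction `e / a ^ k` in the localization `E_a`. -/
def powFrac (a : R) (e : E) (k : ℕ) : LocalizedModule (Submonoid.powers a) E :=
  LocalizedModule.mk e (⟨a ^ k, k, rfl⟩ : Submonoid.powers a)

theorem exists_powFrac (a : R) (z : LocalizedModule (Submonoid.powers a) E) :
    ∃ e k, z = powFrac a e k := by
  induction z using LocalizedModule.induction_on with
  | h e s =>
    obtain ⟨_, k, rfl⟩ := s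
    exact ⟨e, k, rfl⟩

theorem powFrac_eq_iff (a : R) (e e' : E) (k k' : ℕ) :
    powFrac a e k = powFrac a e' k' ↔ ∃ s, a ^ s • a ^ k' • e = a ^ s • a ^ k • e' := by
  rw [powFrac, powFrac, LocalizedModule.mk_eq]
  constructor
  · rintro ⟨⟨_, s, rfl⟩, h⟩
    exact ⟨s, h⟩
  · rintro ⟨s, h⟩
    exact ⟨⟨a ^ s, s, rfl⟩, h⟩

@[simp]
theorem powFrac_zero (a : R) (k : ℕ) : powFrac a (0 : E) k = 0 :=
  LocalizedModule.zero_mk _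

theorem powFrac_eq_zero_iff (a : R) (e : E) (k : ℕ) :
    powFrac a e k = 0 ↔ ∃ s, a ^ s • e = 0 := by
  rw [← powFrac_zero (E := E) a 0, powFrac_eq_iff]
  simp

theorem powFrac_raise (a : R) (e : E) (k s : ℕ) :
    powFrac a e k = powFrac a (a ^ s • e) (k + s) := by
  rw [powFrac_eq_iff]
  exact ⟨0, by simp [smul_smul, pow_add]⟩

theorem powFrac_add (a : R) (e e' : E) (k : ℕ) :
    powFrac a (e + e') k = powFrac a e k + powFrac a e' k := by
  rw [powFrac, powFrac, powFrac, LocalizedModule.mk_add_mk, LocalizedModule.mk_eq]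
  exact ⟨1, by simp [Submonoid.smul_def, smul_smul, smul_add]⟩

theorem powFrac_neg (a : R) (e : E) (k : ℕ) : powFrac a (-e) k = -powFrac a e k :=
  LocalizedModule.mk_neg

theorem powFrac_sub (a : R) (e e' : E) (k : ℕ) :
    powFrac a (e - e') k = powFrac a e k - powFrac a e' k := by
  rw [sub_eq_add_neg, powFrac_add, powFrac_neg, sub_eq_add_neg]

theorem smul_powFrac (a r : R) (e : E) (k : ℕ) : r • powFrac a e k = powFrac a (r • e) k :=
  LocalizedModule.smul'_mk r e _

theorem pow_smul_powFrac (a : R) (e : E) (k : ℕ) : a ^ k • powFrac a e k = powFrac a e 0 := by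
  rw [smul_powFrac, powFrac_raise a e 0 k, zero_add]

theorem localizationRes_powFrac {a b c : R} (h : a ∣ b) (hb : b = a * c) (e : E) (k : ℕ) :
    localizationRes h E (powFrac a e k) = powFrac b (c ^ k • e) k := by
  have hinj : Function.Injective fun z : LocalizedModule (Submonoid.powers b) E => a ^ k • z :=
    ((Module.End.isUnit_iff _).1 (isUnit_algebraMap_end_of_dvd h E ⟨a ^ k, k, rfl⟩)).1
  apply hinj
  have h0 : localizationRes h E (powFrac a e 0) = powFrac b e 0 := by
    have h1 := LocalizedModule.lift_mk_one (Submonoid.powers a)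
      (LocalizedModule.mkLinearMap (Submonoid.powers b) E) (isUnit_algebraMap_end_of_dvd h E) e
    have h2 : (⟨a ^ 0, 0, rfl⟩ : Submonoid.powers a) = 1 := Subtype.ext (pow_zero a)
    have h3 : (⟨b ^ 0, 0, rfl⟩ : Submonoid.powers b) = 1 := Subtype.ext (pow_zero b)
    rw [powFrac, powFrac, h2, h3]
    exact h1
  simp only
  rw [← map_smul, pow_smul_powFrac, h0, smul_powFrac, smul_smul, ← mul_pow, ← hb, ← smul_powFrac,
    pow_smul_powFrac]

theorem localizationRes_comp {a b c : R} (h : a ∣ b) (h' : b ∣ c)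
    (z : LocalizedModule (Submonoid.powers a) E) :
    localizationRes h' E (localizationRes h E z) = localizationRes (h.trans h') E z := by
  obtain ⟨e, k, rfl⟩ := exists_powFrac a z
  obtain ⟨u, hu⟩ := h
  obtain ⟨w, hw⟩ := h'
  rw [localizationRes_powFrac _ hu, localizationRes_powFrac _ hw,
    localizationRes_powFrac (c := u * w) _ (by rw [hw, hu, mul_assoc]), mul_pow, mul_comm, mul_smul]

/-- A fraction that dies in the localization at a multiple `a * c` is killed by a power of `c`. -/
theorem exists_pow_smul_eq_zero_of_localizationRes_eq_zero {a b c : R} (h : a ∣ b) (hb : b = a * c)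
    (z : LocalizedModule (Submonoid.powers a) E) (hz : localizationRes h E z = 0) :
    ∃ s, c ^ s • z = 0 := by
  obtain ⟨e, k, rfl⟩ := exists_powFrac a z
  rw [localizationRes_powFrac h hb, powFrac_eq_zero_iff] at hz
  obtain ⟨s, hs⟩ := hz
  refine ⟨s + k, ?_⟩
  rw [smul_powFrac, powFrac_eq_zero_iff]
  refine ⟨s, ?_⟩
  rwa [hb, mul_pow, mul_smul, smul_smul (c ^ s), ← pow_add] at hs

variable {E' : Type*} [AddCommGroup E'] [Module R E']

/-- The map `E_a → E'_a` induced by a linear map `E → E'`. -/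
def locMap (a : R) (φ : E →ₗ[R] E') :
    LocalizedModule (Submonoid.powers a) E →ₗ[R] LocalizedModule (Submonoid.powers a) E' :=
  IsLocalizedModule.map (Submonoid.powers a) (LocalizedModule.mkLinearMap (Submonoid.powers a) E)
    (LocalizedModule.mkLinearMap (Submonoid.powers a) E') φ

@[simp]
theorem locMap_powFrac (a : R) (φ : E →ₗ[R] E') (e : E) (k : ℕ) :
    locMap a φ (powFrac a e k) = powFrac a (φ e) k := by
  rw [powFrac, powFrac, locMap, IsLocalizedModule.mk_eq_mk', IsLocalizedModule.mk_eq_mk',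
    IsLocalizedModule.map_mk']

theorem locMap_injective (a : R) {φ : E →ₗ[R] E'} (h : Function.Injective φ) :
    Function.Injective (locMap a φ) :=
  IsLocalizedModule.map_injective _ _ _ _ h

theorem locMap_localizationRes {a b : R} (h : a ∣ b) (φ : E →ₗ[R] E')
    (z : LocalizedModule (Submonoid.powers a) E) :
    locMap b φ (localizationRes h E z) = localizationRes h E' (locMap a φ z) := by
  obtain ⟨e, k, rfl⟩ := exists_powFrac a z
  obtain ⟨c, hc⟩ := h
  rw [localizationRes_powFrac _ hc, locMap_powFrac, locMap_powFrac, localizationRes_powFrac _ hc,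
    map_smul]

end Fractions

/-! ### The Čech complex -/

section CechComplex

variable {R : Type*} [CommRing R] {m : ℕ} (f : Fin m → R)
variable {E : Type*} [AddCommGroup E] [Module R E]

/-- A shortcut for instance search. -/
instance cechCochainAddCommGroup (p : ℕ) : AddCommGroup (CechCochain f E p) := inferInstance

/-- A shortcut for instance search. -/
instance cechCochainModule (p : ℕ) : Module R (CechCochain f E p) := inferInstance

theorem cechD_apply {p : ℕ} (c : CechCochain f E p) (σ : Fin (p + 1) ↪o Fin m) :
    cechD f E p c σ = ∑ j : Fin (p + 1), (-1 : R) ^ (j : ℕ) •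
      localizationRes (cechProd_face_dvd f σ j) E (c (cechFace σ j)) := by
  simp [cechD, LinearMap.pi_apply, LinearMap.sum_apply]

theorem localizationRes_congr {p : ℕ} (c : CechCochain f E p) {b : R} {σ τ : Fin p ↪o Fin m}
    (h : σ = τ) (hσ : cechProd f σ ∣ b) (hτ : cechProd f τ ∣ b) :
    localizationRes hσ E (c σ) = localizationRes hτ E (c τ) := by
  subst h
  rfl

/-- `d² = 0`: leaving out two entries in the two possible orders gives the same face with opposite
signs. -/
theorem cechD_cechD {p : ℕ} (c : CechCochain f E p) :
    cechD f E (p + 1) (cechD f E p c) = 0 := by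
  funext σ
  simp only [cechD_apply, map_sum, map_smul, localizationRes_comp, Finset.smul_sum, smul_smul,
    ← pow_add, Pi.zero_apply]
  rw [← Fintype.sum_prod_type' (f := fun (j : Fin (p + 2)) (k : Fin (p + 1)) =>
    (-1 : R) ^ ((j : ℕ) + k) • localizationRes ((cechProd_face_dvd f (cechFace σ j) k).trans
        (cechProd_face_dvd f σ j)) E (c (cechFace (cechFace σ j) k)))]
  have hface : ∀ q : Fin (p + 2) × Fin (p + 1),
      cechFace (cechFace σ (q.1.succAbove q.2)) (q.2.predAbove q.1) =
        cechFace (cechFace σ q.1) q.2 := fun q => by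
    ext k
    exact congrArg (fun l => ((σ l : Fin m) : ℕ))
      (Fin.succAbove_succAbove_succAbove_predAbove q.1 q.2 k)
  have hsgn : ∀ q : Fin (p + 2) × Fin (p + 1),
      (-1 : R) ^ (((q.1.succAbove q.2 : Fin (p + 2)) : ℕ) + (q.2.predAbove q.1 : Fin (p + 1))) =
        -(-1 : R) ^ ((q.1 : ℕ) + q.2) := fun q => by
    have := Fin.even_succAbove_add_predAbove q.1 q.2
    rcases Nat.even_or_odd ((q.1 : ℕ) + q.2) with h | h
    · rw [h.neg_one_pow, Odd.neg_one_pow]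
      rw [← Nat.not_even_iff_odd, this, Nat.not_odd_iff_even]
      exact h
    · rw [h.neg_one_pow, (this.2 h).neg_one_pow, neg_neg]
  refine Finset.sum_involution (fun q _ => (q.1.succAbove q.2, q.2.predAbove q.1)) ?_ ?_ ?_ ?_
  · intro q _
    simp only
    rw [hsgn, localizationRes_congr f c (hface q) _
      ((cechProd_face_dvd f (cechFace σ q.1) q.2).trans (cechProd_face_dvd f σ q.1)), neg_smul,
      add_neg_cancel]
  · intro q _ _ h
    exact Fin.succAbove_ne q.1 q.2 (congrArg Prod.fst h)
  · simp
  · intro q _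
    exact Prod.ext (Fin.succAbove_succAbove_predAbove q.1 q.2)
      (Fin.predAbove_predAbove_succAbove q.1 q.2)

variable {f}
variable {E' : Type*} [AddCommGroup E'] [Module R E']

/-- The map of Čech cochains induced by a linear map. -/
def cechMap (f : Fin m → R) (φ : E →ₗ[R] E') (p : ℕ) : CechCochain f E p →ₗ[R] CechCochain f E' p :=
  LinearMap.pi fun σ => locMap (cechProd f σ) φ ∘ₗ LinearMap.proj σ

@[simp]
theorem cechMap_apply (φ : E →ₗ[R] E') (p : ℕ) (c : CechCochain f E p) (σ : Fin p ↪o Fin m) :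
    cechMap f φ p c σ = locMap (cechProd f σ) φ (c σ) := rfl

theorem cechD_cechMap (φ : E →ₗ[R] E') (p : ℕ) (c : CechCochain f E p) :
    cechD f E' p (cechMap f φ p c) = cechMap f φ (p + 1) (cechD f E p c) := by
  funext σ
  simp only [cechD_apply, cechMap_apply, map_sum, map_smul, locMap_localizationRes]

theorem cechMap_injective {φ : E →ₗ[R] E'} (h : Function.Injective φ) (p : ℕ) :
    Function.Injective (cechMap f φ p) := fun c c' hc => by
  funext σ
  exact locMap_injective _ h (congrFun hc σ)

end CechComplex

/-! ### Homogeneous cochains -/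

/-- Finitely many monotone properties that hold eventually have a common bound. -/
theorem exists_uniform_bound {ι : Type*} [Finite ι] {P : ι → ℕ → Prop}
    (hmono : ∀ i s t, s ≤ t → P i s → P i t) (h : ∀ i, ∃ s, P i s) : ∃ s, ∀ i, P i s := by
  choose s hs using h
  obtain ⟨B, hB⟩ := (Set.finite_range s).bddAbove
  exact ⟨B, fun i => hmono i _ _ (hB ⟨i, rfl⟩) (hs i)⟩

section HomogeneousCochains

variable {R : Type*} [CommRing R] {m : ℕ} {f : Fin m → R}
variable {E : Type*} [AddCommGroup E] [Module R E] {gr : ℤ → AddSubgroup E}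

/-- The elements `f_i` act with degree `1` on the family `gr` of subgroups of `E`. -/
def ActsInDegreeOne (f : Fin m → R) (gr : ℤ → AddSubgroup E) : Prop :=
  ∀ i n, ∀ e ∈ gr n, f i • e ∈ gr (n + 1)

theorem ActsInDegreeOne.pow_smul_mem (h : ActsInDegreeOne f gr) (i : Fin m) (s : ℕ) {n : ℤ} {e : E}
    (he : e ∈ gr n) : f i ^ s • e ∈ gr (n + s) := by
  induction s with
  | zero => simpa using he
  | succ s ih =>
    rw [pow_succ', mul_smul]
    have := h i _ _ ih
    rwa [add_assoc] at this

theorem ActsInDegreeOne.prod_smul_mem (h : ActsInDegreeOne f gr) {p : ℕ} (σ : Fin p → Fin m) {n : ℤ}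
    {e : E} (he : e ∈ gr n) : (∏ k, f (σ k)) • e ∈ gr (n + p) := by
  induction p with
  | zero => simpa using he
  | succ p ih =>
    rw [Fin.prod_univ_succ, mul_smul]
    have := h (σ 0) _ _ (ih fun k => σ k.succ)
    rwa [add_assoc] at this

theorem ActsInDegreeOne.prod_pow_smul_mem (h : ActsInDegreeOne f gr) {p : ℕ} (σ : Fin p → Fin m)
    (s : ℕ) {n : ℤ} {e : E} (he : e ∈ gr n) : (∏ k, f (σ k)) ^ s • e ∈ gr (n + s * p) := by
  induction s with
  | zero => simpa using he
  | succ s ih =>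
    rw [pow_succ', mul_smul]
    have := h.prod_smul_mem σ ih
    convert this using 2
    push_cast
    ring

/-- The fractions of degree `n` already form a subgroup. -/
theorem mem_localizationDeg_iff (h : ActsInDegreeOne f gr) {p : ℕ} (σ : Fin p ↪o Fin m) (n : ℤ)
    (z : LocalizedModule (Submonoid.powers (cechProd f σ)) E) :
    z ∈ localizationDeg gr (cechProd f σ) p n ↔
      ∃ k : ℕ, ∃ e ∈ gr (n + k * p), z = powFrac (cechProd f σ) e k := by
  refine ⟨fun hz => ?_, fun hz => AddSubgroup.subset_closure hz⟩
  induction hz using AddSubgroup.closure_induction with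
  | mem z hz => exact hz
  | zero => exact ⟨0, 0, zero_mem _, by simp⟩
  | neg z _ hz =>
    obtain ⟨k, e, he, rfl⟩ := hz
    exact ⟨k, -e, neg_mem he, (powFrac_neg _ _ _).symm⟩
  | add z w _ _ hz hw =>
    obtain ⟨k, e, he, rfl⟩ := hz
    obtain ⟨l, e', he', rfl⟩ := hw
    refine ⟨k + l, cechProd f σ ^ l • e + cechProd f σ ^ k • e', add_mem ?_ ?_, ?_⟩
    · convert h.prod_pow_smul_mem σ l he using 2
      push_cast
      ring
    · convert h.prod_pow_smul_mem σ k he' using 2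
      push_cast
      ring
    · rw [powFrac_add, ← powFrac_raise, add_comm k l, ← powFrac_raise]

variable (f gr) in
/-- The Čech cochains that are homogeneous of degree `n`. -/
def cechDeg (p : ℕ) (n : ℤ) : AddSubgroup (CechCochain f E p) :=
  AddSubgroup.pi Set.univ fun σ => localizationDeg gr (cechProd f σ) p n

theorem mem_cechDeg {p : ℕ} {n : ℤ} {c : CechCochain f E p} :
    c ∈ cechDeg f gr p n ↔ ∀ σ, c σ ∈ localizationDeg gr (cechProd f σ) p n := by
  simp [cechDeg, AddSubgroup.mem_pi]

theorem cechProd_eq_face_mul {p : ℕ} (σ : Fin (p + 1) ↪o Fin m) (j : Fin (p + 1)) :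
    cechProd f σ = cechProd f (cechFace σ j) * f (σ j) := by
  rw [cechProd, Fin.prod_univ_succAbove _ j, mul_comm]
  rfl

theorem neg_one_pow_smul_mem {G : Type*} [AddCommGroup G] [Module R G] (H : AddSubgroup G) (j : ℕ)
    {z : G} (hz : z ∈ H) : (-1 : R) ^ j • z ∈ H := by
  rcases neg_one_pow_eq_or R j with h | h <;> rw [h]
  · rwa [one_smul]
  · rw [neg_smul, one_smul]
    exact neg_mem hz

theorem cechD_mem_cechDeg (h : ActsInDegreeOne f gr) {p : ℕ} {n : ℤ} {c : CechCochain f E p}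
    (hc : c ∈ cechDeg f gr p n) : cechD f E p c ∈ cechDeg f gr (p + 1) n := by
  rw [mem_cechDeg] at hc ⊢
  intro σ
  rw [cechD_apply]
  refine sum_mem fun j _ => neg_one_pow_smul_mem _ _ ?_
  obtain ⟨k, e, he, hk⟩ := (mem_localizationDeg_iff h _ _ _).1 (hc (cechFace σ j))
  rw [hk, localizationRes_powFrac _ (cechProd_eq_face_mul σ j), mem_localizationDeg_iff h]
  refine ⟨k, _, ?_, rfl⟩
  convert h.pow_smul_mem (σ j) k he using 2
  push_cast
  ring

theorem pow_smul_mem_localizationDeg (h : ActsInDegreeOne f gr) (i : Fin m) (s : ℕ) {p : ℕ} {n : ℤ}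
    {σ : Fin p ↪o Fin m} {z : LocalizedModule (Submonoid.powers (cechProd f σ)) E}
    (hz : z ∈ localizationDeg gr (cechProd f σ) p n) :
    f i ^ s • z ∈ localizationDeg gr (cechProd f σ) p (n + s) := by
  obtain ⟨k, e, he, hk⟩ := (mem_localizationDeg_iff h _ _ _).1 hz
  rw [hk, smul_powFrac, mem_localizationDeg_iff h]
  refine ⟨k, _, ?_, rfl⟩
  convert h.pow_smul_mem i s he using 2
  ring

theorem pow_smul_mem_cechDeg (h : ActsInDegreeOne f gr) (i : Fin m) (s : ℕ) {p : ℕ} {n : ℤ}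
    {c : CechCochain f E p} (hc : c ∈ cechDeg f gr p n) :
    f i ^ s • c ∈ cechDeg f gr p (n + s) :=
  mem_cechDeg.2 fun σ => pow_smul_mem_localizationDeg h i s (mem_cechDeg.1 hc σ)

variable (gr) in
/-- `c` is the coboundary of a homogeneous cochain of degree `n`; in cohomological degree `0` this
means `c = 0`. -/
def IsHomogeneousCoboundary (n : ℤ) : ∀ {p : ℕ}, CechCochain f E p → Prop
  | 0, c => c = 0
  | p + 1, c => ∃ b ∈ cechDeg f gr p n, cechD f E p b = c

variable (f gr) in
/-- The vanishing of the `p`-th cohomology of the degree `n` strand of the Čech complex. -/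
def CechVanishes (p : ℕ) (n : ℤ) : Prop :=
  ∀ c ∈ cechDeg f gr p n, cechD f E p c = 0 → IsHomogeneousCoboundary gr n c

/-! ### Local cohomology classes are killed by powers of the `f_i` -/

/-- The index `τ ∪ {i}`, for `i ∉ τ`. -/
theorem exists_insert {p : ℕ} (τ : Fin p ↪o Fin m) {i : Fin m} (hi : i ∉ Set.range τ) :
    ∃ (ρ : Fin (p + 1) ↪o Fin m) (q : Fin (p + 1)), ρ q = i ∧ cechFace ρ q = τ := by
  classical
  have hi' : i ∉ Finset.univ.map τ.toEmbedding := by simpa using hi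
  have hcard : (insert i (Finset.univ.map τ.toEmbedding)).card = p + 1 := by
    rw [Finset.card_insert_of_notMem hi', Finset.card_map, Finset.card_univ, Fintype.card_fin]
  have hcard' : (Finset.univ.map τ.toEmbedding).card = p := by
    rw [Finset.card_map, Finset.card_univ, Fintype.card_fin]
  have hmem : i ∈ Set.range (Finset.orderEmbOfFin _ hcard) := by simp
  obtain ⟨q, hq⟩ := hmem
  refine ⟨Finset.orderEmbOfFin _ hcard, q, hq, ?_⟩
  refine Eq.trans ?_ (Finset.orderEmbOfFin_unique' hcard' (f := τ) (by simp)).symm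
  refine Finset.orderEmbOfFin_unique' hcard' fun k => ?_
  have h1 := Finset.orderEmbOfFin_mem _ hcard (q.succAbove k)
  refine (Finset.mem_insert.1 h1).resolve_left fun h2 => ?_
  exact Fin.succAbove_ne q k ((Finset.orderEmbOfFin _ hcard).injective (h2.trans hq.symm))

theorem insert_unique {p : ℕ} {ρ ρ' : Fin (p + 1) ↪o Fin m} {q q' : Fin (p + 1)}
    (h : ρ q = ρ' q') (hf : cechFace ρ q = cechFace ρ' q') : ρ = ρ' ∧ q = q' := by
  classical
  have hcard : (Finset.univ.map ρ'.toEmbedding).card = p + 1 := by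
    rw [Finset.card_map, Finset.card_univ, Fintype.card_fin]
  have hρ : ρ = ρ' := by
    rw [Finset.orderEmbOfFin_unique' hcard (f := ρ') (by simp)]
    refine Finset.orderEmbOfFin_unique' hcard fun k => ?_
    rcases Fin.eq_self_or_eq_succAbove q k with rfl | ⟨l, rfl⟩
    · rw [h]
      simp
    · have := DFunLike.congr_fun hf l
      simp only [cechFace, RelEmbedding.trans_apply, Fin.succAboveOrderEmb_apply] at this
      simp [this]
  subst hρ
  exact ⟨rfl, ρ.injective h⟩

theorem mem_range_cechFace {p : ℕ} {ρ : Fin (p + 1) ↪o Fin m} {q j : Fin (p + 1)} (h : j ≠ q) :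
    ρ q ∈ Set.range (cechFace ρ j) := by
  obtain ⟨l, hl⟩ := Fin.exists_succAbove_eq h.symm
  exact ⟨l, by simp [cechFace, hl]⟩

theorem notMem_range_cechFace {p : ℕ} {ρ : Fin (p + 1) ↪o Fin m} {q : Fin (p + 1)} :
    ρ q ∉ Set.range (cechFace ρ q) := by
  rintro ⟨l, hl⟩
  exact Fin.succAbove_ne q l (ρ.injective hl)

/-- A cocycle whose components at all `σ ∋ i` vanish is killed by a power of `f_i`: the cocycle
condition at `σ ∪ {i}` says that the component at `σ` dies in `E_{f_σ f_i}`. -/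
theorem exists_pow_smul_eq_zero_of_cocycle {p : ℕ} {c : CechCochain f E p}
    (hc : cechD f E p c = 0) (i : Fin m) (hi : ∀ σ : Fin p ↪o Fin m, i ∈ Set.range σ → c σ = 0) :
    ∃ s, f i ^ s • c = 0 := by
  have key : ∀ σ : Fin p ↪o Fin m, ∃ s, f i ^ s • c σ = 0 := fun σ => by
    by_cases h : i ∈ Set.range σ
    · exact ⟨0, by rw [hi σ h, smul_zero]⟩
    obtain ⟨ρ, q, hq, hρ⟩ := exists_insert σ h
    have h1 := congrFun hc ρ
    rw [cechD_apply, Finset.sum_eq_single q] at h1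
    · subst hρ
      have h2 : localizationRes (cechProd_face_dvd f ρ q) E (c (cechFace ρ q)) = 0 := by
        have h3 := congrArg (fun z => (-1 : R) ^ (q : ℕ) • z) h1
        simpa [smul_smul, ← pow_add, ← two_mul] using h3
      rw [← hq]
      exact exists_pow_smul_eq_zero_of_localizationRes_eq_zero _ (cechProd_eq_face_mul ρ q) _ h2
    · intro j _ hj
      rw [hi _ (hq ▸ mem_range_cechFace hj), map_zero, smul_zero]
    · simp
  obtain ⟨s, hs⟩ := exists_uniform_bound (P := fun σ s => f i ^ s • c σ = 0) (fun σ s t hst h => by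
    rw [← Nat.sub_add_cancel hst, pow_add, mul_smul, h, smul_zero]) key
  exact ⟨s, funext hs⟩

/-- Every Čech cohomology class is killed by a power of each `f_i`: contracting a cocycle `c` along
`i` gives a cochain `b` with `b_τ = ± f_i^s c_{τ ∪ i}` for `i ∉ τ`, and `f_i^s c - d b` vanishes at
all `σ ∋ i`. -/
theorem exists_pow_smul_isHomogeneousCoboundary (h : ActsInDegreeOne f gr) {p : ℕ} {n : ℤ}
    {c : CechCochain f E p} (hc : c ∈ cechDeg f gr p n) (hd : cechD f E p c = 0) (i : Fin m) :
    ∃ s : ℕ, IsHomogeneousCoboundary gr (n + s) (f i ^ s • c) := by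
  cases p with
  | zero => exact exists_pow_smul_eq_zero_of_cocycle hd i fun σ ⟨k, _⟩ => k.elim0
  | succ p =>
    have key : ∀ τ : Fin p ↪o Fin m, ∃ s : ℕ, ∃ z ∈ localizationDeg gr (cechProd f τ) p (n + s),
        (i ∈ Set.range τ → z = 0) ∧ ∀ (ρ : Fin (p + 1) ↪o Fin m) (q : Fin (p + 1)) (_ : ρ q = i)
          (hτ : cechFace ρ q = τ), localizationRes (hτ ▸ cechProd_face_dvd f ρ q) E z =
            (-1 : R) ^ (q : ℕ) • f i ^ s • c ρ := fun τ => by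
      by_cases hi : i ∈ Set.range τ
      · exact ⟨0, 0, zero_mem _, fun _ => rfl, fun ρ q hq hτ =>
          absurd (hq ▸ hτ ▸ hi) (notMem_range_cechFace (ρ := ρ) (q := q))⟩
      obtain ⟨ρ, q, hq, rfl⟩ := exists_insert τ hi
      -- With `c_ρ = e / f_ρ^k`, the fraction `e / f_τ^k` maps to `f_i^k c_ρ`.
      obtain ⟨k, e, he, hk⟩ := (mem_localizationDeg_iff h _ _ _).1 (mem_cechDeg.1 hc ρ)
      refine ⟨k, (-1 : R) ^ (q : ℕ) • powFrac _ e k, neg_one_pow_smul_mem _ _ ?_,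
        fun h => absurd h hi, fun ρ' q' hq' hτ' => ?_⟩
      · rw [mem_localizationDeg_iff h]
        refine ⟨k, e, ?_, rfl⟩
        convert he using 2
        push_cast
        ring
      · obtain ⟨rfl, rfl⟩ := insert_unique (hq'.trans hq.symm) hτ'
        rw [map_smul, localizationRes_powFrac _ (cechProd_eq_face_mul ρ' q'), hk, hq, smul_powFrac,
          smul_powFrac, smul_powFrac]
    obtain ⟨s, hs⟩ := exists_uniform_bound (fun τ s t hst => by
      rintro ⟨z, hz, h0, hres⟩
      refine ⟨f i ^ (t - s) • z, ?_, fun hi => by rw [h0 hi, smul_zero], fun ρ q hq hτ => ?_⟩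
      · convert pow_smul_mem_localizationDeg h i (t - s) hz using 2
        push_cast [hst]
        ring
      · rw [map_smul, hres ρ q hq hτ, smul_comm, smul_smul (f i ^ (t - s)), ← pow_add,
          Nat.sub_add_cancel hst]) key
    choose b hb hb0 hbres using hs
    have hbdeg : b ∈ cechDeg f gr p (n + s) := mem_cechDeg.2 hb
    have hvan : ∀ σ : Fin (p + 1) ↪o Fin m, i ∈ Set.range σ →
        (f i ^ s • c - cechD f E p b) σ = 0 := by
      rintro σ ⟨q, hq⟩
      rw [Pi.sub_apply, sub_eq_zero, cechD_apply, Finset.sum_eq_single q]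
      · rw [hbres _ σ q hq rfl, smul_smul, ← pow_add, ← two_mul, pow_mul]
        simp
      · intro j _ hj
        rw [hb0 _ (hq ▸ mem_range_cechFace hj), map_zero, smul_zero]
      · simp
    obtain ⟨t, ht⟩ := exists_pow_smul_eq_zero_of_cocycle
      (by rw [map_sub, map_smul, hd, cechD_cechD, smul_zero, sub_zero]) i hvan
    refine ⟨t + s, f i ^ t • b, ?_, ?_⟩
    · convert pow_smul_mem_cechDeg h i t hbdeg using 2
      push_cast
      ring
    · rw [smul_sub, sub_eq_zero, smul_smul, ← pow_add] at ht
      rw [ht, map_smul]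

end HomogeneousCochains

/-! ### Long exact sequences -/

section ShortExact

variable {R : Type*} [CommRing R] {m : ℕ} {f : Fin m → R}
variable {E' E E'' : Type*} [AddCommGroup E'] [Module R E'] [AddCommGroup E] [Module R E]
  [AddCommGroup E''] [Module R E'']

/-- A short exact sequence `0 → E' → E → E'' → 0` of modules whose homogeneous parts form short
exact sequences `0 → E'_n → E_n → E''_n → 0`. -/
structure GradedShortExact (φ : E' →ₗ[R] E) (ψ : E →ₗ[R] E'') (gr' : ℤ → AddSubgroup E')
    (gr : ℤ → AddSubgroup E) (gr'' : ℤ → AddSubgroup E'') : Prop where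
  injective : Function.Injective φ
  exact : Function.Exact φ ψ
  map_mem_iff : ∀ {n e}, φ e ∈ gr n ↔ e ∈ gr' n
  map_mem : ∀ {n e}, e ∈ gr n → ψ e ∈ gr'' n
  exists_lift : ∀ {n} {e : E''}, e ∈ gr'' n → ∃ e' ∈ gr n, ψ e' = e

variable {φ : E' →ₗ[R] E} {ψ : E →ₗ[R] E''} {gr' : ℤ → AddSubgroup E'}
    {gr : ℤ → AddSubgroup E} {gr'' : ℤ → AddSubgroup E''}

namespace GradedShortExact

theorem actsInDegreeOne_left (H : GradedShortExact φ ψ gr' gr gr'') (h : ActsInDegreeOne f gr) :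
    ActsInDegreeOne f gr' := fun i n e he => by
  rw [← H.map_mem_iff] at he ⊢
  rw [map_smul]
  exact h i n _ he

theorem actsInDegreeOne_right (H : GradedShortExact φ ψ gr' gr gr'') (h : ActsInDegreeOne f gr) :
    ActsInDegreeOne f gr'' := fun i n e he => by
  obtain ⟨e, he', rfl⟩ := H.exists_lift he
  rw [← map_smul]
  exact H.map_mem (h i n _ he')

theorem cechMap_left_mem (H : GradedShortExact φ ψ gr' gr gr'') (h : ActsInDegreeOne f gr) {p : ℕ}
    {n : ℤ} {c : CechCochain f E' p} (hc : c ∈ cechDeg f gr' p n) :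
    cechMap f φ p c ∈ cechDeg f gr p n := by
  rw [mem_cechDeg] at hc ⊢
  intro σ
  obtain ⟨k, e, he, hk⟩ := (mem_localizationDeg_iff (H.actsInDegreeOne_left h) _ _ _).1 (hc σ)
  rw [cechMap_apply, hk, locMap_powFrac, mem_localizationDeg_iff h]
  exact ⟨k, _, H.map_mem_iff.2 he, rfl⟩

theorem cechMap_right_mem (H : GradedShortExact φ ψ gr' gr gr'') (h : ActsInDegreeOne f gr) {p : ℕ}
    {n : ℤ} {c : CechCochain f E p} (hc : c ∈ cechDeg f gr p n) :
    cechMap f ψ p c ∈ cechDeg f gr'' p n := by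
  rw [mem_cechDeg] at hc ⊢
  intro σ
  obtain ⟨k, e, he, hk⟩ := (mem_localizationDeg_iff h _ _ _).1 (hc σ)
  rw [cechMap_apply, hk, locMap_powFrac, mem_localizationDeg_iff (H.actsInDegreeOne_right h)]
  exact ⟨k, _, H.map_mem he, rfl⟩

theorem exists_cechMap_right_eq (H : GradedShortExact φ ψ gr' gr gr'') (h : ActsInDegreeOne f gr)
    {p : ℕ} {n : ℤ} {c : CechCochain f E'' p} (hc : c ∈ cechDeg f gr'' p n) :
    ∃ b ∈ cechDeg f gr p n, cechMap f ψ p b = c := by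
  have key : ∀ σ, ∃ z ∈ localizationDeg gr (cechProd f σ) p n, locMap _ ψ z = c σ := fun σ => by
    obtain ⟨k, e, he, hk⟩ :=
      (mem_localizationDeg_iff (H.actsInDegreeOne_right h) _ _ _).1 (mem_cechDeg.1 hc σ)
    obtain ⟨e, he', rfl⟩ := H.exists_lift he
    exact ⟨powFrac _ e k, (mem_localizationDeg_iff h _ _ _).2 ⟨k, e, he', rfl⟩, by
      rw [hk, locMap_powFrac]⟩
  choose b hb hbc using key
  exact ⟨b, mem_cechDeg.2 hb, funext hbc⟩

theorem exists_cechMap_left_eq (H : GradedShortExact φ ψ gr' gr gr'') (h : ActsInDegreeOne f gr)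
    {p : ℕ} {n : ℤ} {c : CechCochain f E p} (hc : c ∈ cechDeg f gr p n)
    (h0 : cechMap f ψ p c = 0) : ∃ b ∈ cechDeg f gr' p n, cechMap f φ p b = c := by
  have key : ∀ σ, ∃ z ∈ localizationDeg gr' (cechProd f σ) p n, locMap _ φ z = c σ := fun σ => by
    obtain ⟨k, e, he, hk⟩ := (mem_localizationDeg_iff h _ _ _).1 (mem_cechDeg.1 hc σ)
    have h1 := congrFun h0 σ
    rw [cechMap_apply, hk, locMap_powFrac, Pi.zero_apply, powFrac_eq_zero_iff] at h1
    obtain ⟨s, hs⟩ := h1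
    rw [← map_smul] at hs
    obtain ⟨e', he'⟩ := (H.exact _).1 hs
    refine ⟨powFrac _ e' (k + s), (mem_localizationDeg_iff (H.actsInDegreeOne_left h) _ _ _).2
      ⟨k + s, e', ?_, rfl⟩, by rw [hk, locMap_powFrac, he', ← powFrac_raise]⟩
    rw [← H.map_mem_iff, he']
    convert h.prod_pow_smul_mem σ s he using 2
    push_cast
    ring
  choose b hb hbc using key
  exact ⟨b, mem_cechDeg.2 hb, funext hbc⟩

/-- Exactness of `H^p(E')_n → H^p(E)_n → H^p(E'')_n`. -/
theorem cechVanishes_middle (H : GradedShortExact φ ψ gr' gr gr'') (h : ActsInDegreeOne f gr)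
    {p : ℕ} {n : ℤ} (h' : CechVanishes f gr' p n) (h'' : CechVanishes f gr'' p n) :
    CechVanishes f gr p n := by
  intro c hc hd
  have h1 := h'' _ (H.cechMap_right_mem h hc) (by rw [cechD_cechMap, hd, map_zero])
  cases p with
  | zero =>
    obtain ⟨b, hb, rfl⟩ := H.exists_cechMap_left_eq h hc h1
    have h2 : b = 0 := h' b hb (cechMap_injective H.injective _ (by
      rw [← cechD_cechMap, hd, map_zero]))
    change cechMap f φ 0 b = 0
    rw [h2, map_zero]
  | succ p =>
    obtain ⟨a, ha, hac⟩ := h1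
    obtain ⟨a, ha', rfl⟩ := H.exists_cechMap_right_eq h ha
    rw [cechD_cechMap] at hac
    obtain ⟨b, hb, hbc⟩ := H.exists_cechMap_left_eq h (sub_mem hc (cechD_mem_cechDeg h ha'))
      (by rw [map_sub, hac, sub_self])
    obtain ⟨b', hb', rfl⟩ := h' b hb (cechMap_injective H.injective _ (by
      rw [← cechD_cechMap, hbc, map_sub, hd, cechD_cechD, sub_zero, map_zero]))
    refine ⟨cechMap f φ p b' + a, add_mem (H.cechMap_left_mem h hb') ha', ?_⟩
    rw [map_add, cechD_cechMap, hbc, sub_add_cancel]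

/-- Exactness of `H^{p-1}(E'')_n → H^p(E')_n → H^p(E)_n`. -/
theorem isHomogeneousCoboundary_of_map (H : GradedShortExact φ ψ gr' gr gr'')
    (h : ActsInDegreeOne f gr) {p : ℕ} {n : ℤ} (h'' : ∀ q, p = q + 1 → CechVanishes f gr'' q n)
    {c : CechCochain f E' p}
    (hb : IsHomogeneousCoboundary gr n (cechMap f φ p c)) : IsHomogeneousCoboundary gr' n c := by
  cases p with
  | zero => exact cechMap_injective H.injective _ (hb.trans (map_zero _).symm)
  | succ p =>
    obtain ⟨b, hb, hbc⟩ := hb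
    have h1 := h'' p rfl _ (H.cechMap_right_mem h hb) (by
      rw [cechD_cechMap, hbc]
      funext σ
      obtain ⟨e, k, hk⟩ := exists_powFrac _ (c σ)
      rw [cechMap_apply, cechMap_apply, hk, locMap_powFrac, locMap_powFrac,
        H.exact.apply_apply_eq_zero, powFrac_zero, Pi.zero_apply])
    have key : ∃ a ∈ cechDeg f gr p n, cechD f E p a = 0 ∧ cechMap f ψ p (b - a) = 0 := by
      cases p with
      | zero => exact ⟨0, zero_mem _, map_zero _, by rw [sub_zero]; exact h1⟩
      | succ p =>
        obtain ⟨a, ha, hab⟩ := h1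
        obtain ⟨a, ha', rfl⟩ := H.exists_cechMap_right_eq h ha
        exact ⟨cechD f E p a, cechD_mem_cechDeg h ha', cechD_cechD _ _, by
          rw [map_sub, ← hab, cechD_cechMap, sub_self]⟩
    obtain ⟨a, ha, hda, hab⟩ := key
    obtain ⟨b', hb', hbb⟩ := H.exists_cechMap_left_eq h (sub_mem hb ha) hab
    refine ⟨b', hb', cechMap_injective H.injective _ ?_⟩
    rw [← cechD_cechMap, hbb, map_sub, hda, sub_zero, hbc]

/-- Exactness of `H^p(E)_n → H^p(E'')_n → H^{p+1}(E')_n`. -/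
theorem cechVanishes_right (H : GradedShortExact φ ψ gr' gr gr'') (h : ActsInDegreeOne f gr)
    {p : ℕ} {n : ℤ} (h0 : CechVanishes f gr p n) (h' : CechVanishes f gr' (p + 1) n) :
    CechVanishes f gr'' p n := by
  intro c hc hd
  obtain ⟨c, hc', rfl⟩ := H.exists_cechMap_right_eq h hc
  rw [cechD_cechMap] at hd
  obtain ⟨e, he, hec⟩ := H.exists_cechMap_left_eq h (cechD_mem_cechDeg h hc') hd
  obtain ⟨b, hb, rfl⟩ := h' e he (cechMap_injective H.injective _ (by
    rw [← cechD_cechMap, hec, cechD_cechD, map_zero]))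
  have hψφ : cechMap f ψ p (cechMap f φ p b) = 0 := by
    funext σ
    obtain ⟨e, k, hk⟩ := exists_powFrac _ (b σ)
    rw [cechMap_apply, cechMap_apply, hk, locMap_powFrac, locMap_powFrac,
      H.exact.apply_apply_eq_zero, powFrac_zero, Pi.zero_apply]
  have h1 := h0 _ (sub_mem hc' (H.cechMap_left_mem h hb))
    (by rw [map_sub, cechD_cechMap, hec, sub_self])
  have h2 : cechMap f ψ p c = cechMap f ψ p (c - cechMap f φ p b) := by
    rw [map_sub, hψφ, sub_zero]
  rw [h2]
  cases p with
  | zero =>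
    change cechMap f ψ 0 _ = 0
    rw [show c - cechMap f φ 0 b = 0 from h1, map_zero]
  | succ p =>
    obtain ⟨a, ha, hac⟩ := h1
    exact ⟨cechMap f ψ p a, H.cechMap_right_mem h ha, by rw [← hac, cechD_cechMap]⟩

end GradedShortExact

end ShortExact

/-! ### Serre vanishing -/

section SerreVanishing

variable {A : Type*} [CommRing A] {R : Type*} [CommRing R] {m : ℕ} {f : Fin m → R}

section Grading

variable {E : Type w} [AddCommGroup E] [Module R E] [Module A E]

/-- `E = ⨁ gr n`, with projections `π n`, is a grading for which the `f_i` have degree `1` and the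
scalars from `A` have degree `0`. -/
structure IsGradingWith (f : Fin m → R) (gr : ℤ → AddSubgroup E) (π : ℤ → E →ₗ[A] E) :
    Prop where
  mem : ∀ n e, π n e ∈ gr n
  eq_self : ∀ {n e}, e ∈ gr n → π n e = e
  eq_zero : ∀ {n k e}, n ≠ k → e ∈ gr k → π n e = 0
  exists_sum : ∀ e, ∃ s : Finset ℤ, ∑ n ∈ s, π n e = e
  smul : ∀ n i e, π (n + 1) (f i • e) = f i • π n e

namespace IsGradingWith

variable {gr : ℤ → AddSubgroup E} {π : ℤ → E →ₗ[A] E}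

theorem actsInDegreeOne (H : IsGradingWith f gr π) : ActsInDegreeOne f gr := fun i n e he => by
  rw [← H.eq_self he, ← H.smul]
  exact H.mem _ _

theorem exists_forall_ge_eq_zero (H : IsGradingWith f gr π) (e : E) :
    ∃ n₀ : ℤ, ∀ n ≥ n₀, π n e = 0 := by
  obtain ⟨s, hs⟩ := H.exists_sum e
  obtain ⟨B, hB⟩ := s.bddAbove
  refine ⟨B + 1, fun n hn => ?_⟩
  rw [← hs, map_sum]
  refine Finset.sum_eq_zero fun k hk => H.eq_zero ?_ (H.mem k e)
  have := hB hk
  lia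

variable [Algebra A R] [IsScalarTower A R E]

/-- The grading induced on a submodule that is stable under the projections. -/
theorem submodule (H : IsGradingWith f gr π) (N : Submodule R E) (hN : ∀ n, ∀ e ∈ N, π n e ∈ N) :
    ∃ π' : ℤ → N →ₗ[A] N,
      IsGradingWith f (fun n => (gr n).comap N.subtype.toAddMonoidHom) π' := by
  refine ⟨fun n =>
    { toFun := fun e => ⟨π n e, hN n e e.2⟩
      map_add' := fun a b => Subtype.ext (map_add (π n) (a : E) b)
      map_smul' := fun a b => Subtype.ext ((π n).map_smul a (b : E)) }, ?_⟩
  constructor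
  · exact fun n e => H.mem n e
  · exact fun he => Subtype.ext (H.eq_self he)
  · exact fun hnk he => Subtype.ext (H.eq_zero hnk he)
  · intro e
    obtain ⟨s, hs⟩ := H.exists_sum e
    refine ⟨s, Subtype.ext ?_⟩
    rw [AddSubmonoidClass.coe_finsetSum]
    exact hs
  · exact fun n i e => Subtype.ext (H.smul n i e)

/-- The grading induced on the quotient by a submodule that is stable under the projections. -/
theorem quotient (H : IsGradingWith f gr π) (N : Submodule R E) (hN : ∀ n, ∀ e ∈ N, π n e ∈ N) :
    ∃ π' : ℤ → (E ⧸ N) →ₗ[A] E ⧸ N,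
      IsGradingWith f (fun n => (gr n).map N.mkQ.toAddMonoidHom) π' := by
  let ε := Submodule.Quotient.restrictScalarsEquiv A N
  let π' : ℤ → (E ⧸ N) →ₗ[A] E ⧸ N := fun n =>
    ε.toLinearMap ∘ₗ (N.restrictScalars A).mapQ (N.restrictScalars A) (π n) (hN n) ∘ₗ
      ε.symm.toLinearMap
  have hπ : ∀ n e, π' n (N.mkQ e) = N.mkQ (π n e) := fun n e => rfl
  refine ⟨π', ?_⟩
  constructor
  · intro n e
    obtain ⟨e, rfl⟩ := N.mkQ_surjective e
    exact ⟨π n e, H.mem n e, (hπ n e).symm⟩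
  · rintro n _ ⟨e, he, rfl⟩
    exact (hπ n e).trans (congrArg _ (H.eq_self he))
  · rintro n k _ hnk ⟨e, he, rfl⟩
    exact (hπ n e).trans ((congrArg _ (H.eq_zero hnk he)).trans (map_zero _))
  · intro e
    obtain ⟨e, rfl⟩ := N.mkQ_surjective e
    obtain ⟨s, hs⟩ := H.exists_sum e
    refine ⟨s, ?_⟩
    simp only [hπ]
    rw [← map_sum, hs]
  · intro n i e
    obtain ⟨e, rfl⟩ := N.mkQ_surjective e
    rw [← map_smul, hπ, hπ, H.smul, map_smul]

end IsGradingWith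

theorem gradedShortExact_mkQ (N : Submodule R E) (gr : ℤ → AddSubgroup E) :
    GradedShortExact N.subtype N.mkQ (fun n => (gr n).comap N.subtype.toAddMonoidHom) gr
      (fun n => (gr n).map N.mkQ.toAddMonoidHom) where
  injective := N.injective_subtype
  exact := LinearMap.exact_subtype_mkQ N
  map_mem_iff := Iff.rfl
  map_mem := fun he => ⟨_, he, rfl⟩
  exists_lift := fun ⟨e, he, h⟩ => ⟨e, he, h⟩

/-- The cohomology of `E` vanishes in all large degrees. -/
def EventuallyCechVanishes (f : Fin m → R) (gr : ℤ → AddSubgroup E) : Prop :=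
  ∀ p, ∃ n₀ : ℤ, ∀ n ≥ n₀, CechVanishes f gr p n

theorem EventuallyCechVanishes.of_submodule {gr : ℤ → AddSubgroup E} (h : ActsInDegreeOne f gr)
    (N : Submodule R E)
    (h' : EventuallyCechVanishes f (fun n => (gr n).comap N.subtype.toAddMonoidHom))
    (h'' : EventuallyCechVanishes f (fun n => (gr n).map N.mkQ.toAddMonoidHom)) :
    EventuallyCechVanishes f gr := fun p => by
  obtain ⟨a, ha⟩ := h' p
  obtain ⟨b, hb⟩ := h'' p
  exact ⟨max a b, fun n hn => (gradedShortExact_mkQ N gr).cechVanishes_middle h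
    (ha n (le_trans (le_max_left _ _) hn)) (hb n (le_trans (le_max_right _ _) hn))⟩

theorem isHomogeneousCoboundary_zero {gr : ℤ → AddSubgroup E} (n : ℤ) :
    ∀ p, IsHomogeneousCoboundary gr n (0 : CechCochain f E p)
  | 0 => rfl
  | _ + 1 => ⟨0, zero_mem _, map_zero _⟩

variable {gr : ℤ → AddSubgroup E} {π : ℤ → E →ₗ[A] E}

/-- Cochains of degree `n + 1` for the grading `E(-1)` are those of degree `n` for `E`. -/
theorem isHomogeneousCoboundary_shift (h : ActsInDegreeOne f gr) {p : ℕ} {n : ℤ}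
    {c : CechCochain f E p} (hc : IsHomogeneousCoboundary (fun k => gr (k - 1)) (n + 1) c) :
    IsHomogeneousCoboundary gr n c := by
  cases p with
  | zero => exact hc
  | succ p =>
    obtain ⟨b, hb, rfl⟩ := hc
    refine ⟨b, mem_cechDeg.2 fun σ => ?_, rfl⟩
    have h' : ActsInDegreeOne f (fun k => gr (k - 1)) := fun i n e he => by
      have := h i _ _ he
      rwa [sub_add_cancel, ← add_sub_cancel_right n 1] at this
    obtain ⟨k, e, he, hk⟩ := (mem_localizationDeg_iff h' _ _ _).1 (mem_cechDeg.1 hb σ)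
    refine (mem_localizationDeg_iff h _ _ _).2 ⟨k, e, ?_, hk⟩
    convert he using 2
    ring

/-- If `f_i` is injective on `E` and the cohomology of `E / f_i E` vanishes in large degrees, then
`f_i` is injective on the cohomology of `E` in large degrees; but every class is killed by a power
of `f_i`. -/
theorem eventuallyCechVanishes_of_injective (H : IsGradingWith f gr π) (i : Fin m)
    (hinj : Function.Injective (LinearMap.lsmul R E (f i)))
    (h'' : EventuallyCechVanishes f
      (fun n => (gr n).map (LinearMap.range (LinearMap.lsmul R E (f i))).mkQ.toAddMonoidHom)) :
    EventuallyCechVanishes f gr := by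
  have hd := H.actsInDegreeOne
  have hses : GradedShortExact (LinearMap.lsmul R E (f i))
      (LinearMap.range (LinearMap.lsmul R E (f i))).mkQ (fun k => gr (k - 1)) gr
      (fun n => (gr n).map (LinearMap.range (LinearMap.lsmul R E (f i))).mkQ.toAddMonoidHom) :=
    { injective := hinj
      exact := LinearMap.exact_map_mkQ_range _
      map_mem_iff := fun {n e} => by
        rw [LinearMap.lsmul_apply]
        refine ⟨fun he => ?_, fun he => ?_⟩
        · have h1 := H.smul (n - 1) i e
          rw [sub_add_cancel, H.eq_self he] at h1
          rw [hinj h1]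
          exact H.mem _ _
        · have := hd i _ _ he
          rwa [sub_add_cancel] at this
      map_mem := fun he => ⟨_, he, rfl⟩
      exists_lift := fun ⟨e, he, h⟩ => ⟨e, he, h⟩ }
  intro p
  obtain ⟨n₀, hn₀⟩ : ∃ n₀ : ℤ, ∀ n ≥ n₀, ∀ q, p = q + 1 → CechVanishes f
      (fun n => (gr n).map (LinearMap.range (LinearMap.lsmul R E (f i))).mkQ.toAddMonoidHom)
      q n := by
    cases p with
    | zero => exact ⟨0, fun _ _ _ h => by lia⟩
    | succ p =>
      obtain ⟨n₀, hn₀⟩ := h'' p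
      exact ⟨n₀, fun n hn q hq => (Nat.succ.inj hq) ▸ hn₀ n hn⟩
  refine ⟨n₀, fun n hn c hc hdc => ?_⟩
  obtain ⟨s, hs⟩ := exists_pow_smul_isHomogeneousCoboundary hd hc hdc i
  clear hc hdc
  induction s with
  | zero => simpa using hs
  | succ s ih =>
    refine ih ?_
    have hmap : cechMap f (LinearMap.lsmul R E (f i)) p (f i ^ s • c) = f i ^ (s + 1) • c := by
      funext σ
      obtain ⟨e, k, hk⟩ := exists_powFrac _ (c σ)
      rw [cechMap_apply, Pi.smul_apply, Pi.smul_apply, hk, smul_powFrac, locMap_powFrac,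
        LinearMap.lsmul_apply, smul_smul, ← pow_succ', smul_powFrac]
    rw [← hmap] at hs
    push_cast at hs
    rw [← add_assoc] at hs
    exact isHomogeneousCoboundary_shift hd
      (hses.isHomogeneousCoboundary_of_map hd (hn₀ _ (by lia)) hs)

/-- If all the `f_i` kill `E`, then `E` vanishes in large degrees. -/
theorem eventuallyCechVanishes_of_smul_eq_zero [Algebra A R] [IsScalarTower A R E]
    [Module.Finite R E] (H : IsGradingWith f gr π)
    (hadj : Algebra.adjoin A (Set.range f) = ⊤) (h0 : ∀ i, ∀ e : E, f i • e = 0) :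
    EventuallyCechVanishes f gr := by
  have hd := H.actsInDegreeOne
  obtain ⟨n₀, hn₀⟩ : ∃ n₀ : ℤ, ∀ n ≥ n₀, ∀ e, π n e = 0 := by
    obtain ⟨S, hS⟩ := Module.Finite.fg_top (R := R) (M := E)
    have key : ∀ T : Finset E, ∃ n₀ : ℤ, ∀ n ≥ n₀, ∀ e ∈ T, π n e = 0 := by
      classical
      intro T
      induction T using Finset.induction_on with
      | empty => exact ⟨0, by simp⟩
      | insert a T _ ih =>
        obtain ⟨n₁, h1⟩ := ih
        obtain ⟨n₂, h2⟩ := H.exists_forall_ge_eq_zero a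
        refine ⟨max n₁ n₂, fun n hn e he => ?_⟩
        rcases Finset.mem_insert.1 he with rfl | he
        · exact h2 n (le_trans (le_max_right _ _) hn)
        · exact h1 n (le_trans (le_max_left _ _) hn) e he
    obtain ⟨n₀, hn₀⟩ := key S
    refine ⟨n₀, fun n hn e => ?_⟩
    have hsmul : ∀ r : R, ∀ e, π n e = 0 → π n (r • e) = 0 := fun r => by
      have hr : r ∈ Algebra.adjoin A (Set.range f) := hadj ▸ Algebra.mem_top
      induction hr using Algebra.adjoin_induction with
      | mem r hr =>
        obtain ⟨i, rfl⟩ := hr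
        exact fun e _ => by rw [h0, map_zero]
      | algebraMap a => exact fun e he => by rw [algebraMap_smul, map_smul, he, smul_zero]
      | add r r' _ _ hr hr' =>
        exact fun e he => by rw [add_smul, map_add, hr e he, hr' e he, add_zero]
      | mul r r' _ _ hr hr' => exact fun e he => by rw [mul_smul]; exact hr _ (hr' e he)
    have he : e ∈ Submodule.span R (S : Set E) := hS ▸ Submodule.mem_top
    induction he using Submodule.span_induction with
    | mem e he => exact hn₀ n hn e he
    | zero => exact map_zero _
    | add a b _ _ ha hb => rw [map_add, ha, hb, add_zero]
    | smul r a _ ha => exact hsmul r a ha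
  refine fun p => ⟨n₀, fun n hn c hc _ => ?_⟩
  have : c = 0 := by
    funext σ
    obtain ⟨k, e, he, hk⟩ := (mem_localizationDeg_iff hd _ _ _).1 (mem_cechDeg.1 hc σ)
    have h1 : n + k * p ≥ n₀ := by
      have : (0 : ℤ) ≤ k * p := by positivity
      lia
    rw [hk, ← H.eq_self he, hn₀ _ h1, powFrac_zero, Pi.zero_apply]
  rw [this]
  exact isHomogeneousCoboundary_zero n p

end Grading

/-- Serre vanishing for the finitely generated graded modules on which only the `f_i` with `i ∈ T`
act non-trivially, by induction on `T`. In the step, `E` is filtered by the kernel `N` of a high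
power of `f_i` and by the `f_i^s N`; on `E / N` the element `f_i` is injective, and it kills the
other factors. -/
theorem eventuallyCechVanishes_of_support [Algebra A R] (hadj : Algebra.adjoin A (Set.range f) = ⊤)
    (T : Finset (Fin m)) :
    ∀ (E : Type w) [AddCommGroup E] [Module R E] [Module A E] [IsScalarTower A R E]
      [IsNoetherian R E] (gr : ℤ → AddSubgroup E) (π : ℤ → E →ₗ[A] E)
      (_ : IsGradingWith f gr π) (_ : ∀ i ∉ T, ∀ e : E, f i • e = 0),
      EventuallyCechVanishes f gr := by
  classical
  induction T using Finset.induction_on with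
  | empty =>
    intro E _ _ _ _ _ gr π H h0
    exact eventuallyCechVanishes_of_smul_eq_zero H hadj fun i => h0 i (by simp)
  | insert i T _ ih =>
    have hstable : ∀ (E : Type w) [AddCommGroup E] [Module R E] [Module A E] [IsScalarTower A R E]
        (gr : ℤ → AddSubgroup E) (π : ℤ → E →ₗ[A] E) (_ : IsGradingWith f gr π) (n : ℤ),
        ∀ e ∈ LinearMap.range (LinearMap.lsmul R E (f i)),
          π n e ∈ LinearMap.range (LinearMap.lsmul R E (f i)) := by
      rintro E _ _ _ _ gr π H n _ ⟨e, rfl⟩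
      refine ⟨π (n - 1) e, ?_⟩
      have := H.smul (n - 1) i e
      rw [sub_add_cancel] at this
      exact this.symm
    have hquot : ∀ (E : Type w) [AddCommGroup E] [Module R E] [Module A E] [IsScalarTower A R E]
        [IsNoetherian R E] (gr : ℤ → AddSubgroup E) (π : ℤ → E →ₗ[A] E)
        (_ : IsGradingWith f gr π) (_ : ∀ j ∉ insert i T, ∀ e : E, f j • e = 0),
        EventuallyCechVanishes f (fun n =>
          (gr n).map (LinearMap.range (LinearMap.lsmul R E (f i))).mkQ.toAddMonoidHom) := by
      intro E _ _ _ _ _ gr π H h0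
      obtain ⟨π', H'⟩ := H.quotient _ (hstable E gr π H)
      refine ih _ _ π' H' fun j hj e => ?_
      obtain ⟨e, rfl⟩ := Submodule.mkQ_surjective _ e
      rw [← map_smul]
      by_cases hji : j = i
      · subst hji
        exact (Submodule.Quotient.mk_eq_zero _).2 ⟨e, rfl⟩
      · rw [h0 j (by simp [hji, hj]), map_zero]
    have hnil : ∀ (t : ℕ) (E : Type w) [AddCommGroup E] [Module R E] [Module A E]
        [IsScalarTower A R E] [IsNoetherian R E] (gr : ℤ → AddSubgroup E) (π : ℤ → E →ₗ[A] E)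
        (_ : IsGradingWith f gr π) (_ : ∀ j ∉ insert i T, ∀ e : E, f j • e = 0)
        (_ : ∀ e : E, f i ^ t • e = 0), EventuallyCechVanishes f gr := by
      intro t
      induction t with
      | zero =>
        intro E _ _ _ _ _ gr π H _ ht
        have hE : ∀ e : E, e = 0 := by simpa using ht
        exact ih E gr π H fun j _ e => hE _
      | succ t iht =>
        intro E _ _ _ _ _ gr π H h0 ht
        obtain ⟨π', H'⟩ := H.submodule _ (hstable E gr π H)
        refine EventuallyCechVanishes.of_submodule H.actsInDegreeOne
          (LinearMap.range (LinearMap.lsmul R E (f i))) (iht _ _ π' H' ?_ ?_)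
          (hquot E gr π H h0)
        · exact fun j hj e => Subtype.ext (h0 j hj e)
        · rintro ⟨_, e, rfl⟩
          refine Subtype.ext ?_
          change f i ^ t • f i • e = 0
          rw [smul_smul, ← pow_succ, ht]
    intro E _ _ _ _ _ gr π H h0
    -- The kernels of the powers of `f_i` are stationary, so `f_i` is injective modulo `ker f_i^t`.
    obtain ⟨t, ht⟩ := monotone_stabilizes_iff_noetherian.2 ‹IsNoetherian R E›
      ⟨fun s => LinearMap.ker (LinearMap.lsmul R E (f i ^ s)), fun s s' hss e he => by
        rw [LinearMap.mem_ker, LinearMap.lsmul_apply] at he ⊢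
        rw [← Nat.sub_add_cancel hss, pow_add, mul_smul, he, smul_zero]⟩
    have hpow : ∀ (s : ℕ) (n : ℤ) (e : E), π (n + s) (f i ^ s • e) = f i ^ s • π n e := by
      intro s
      induction s with
      | zero => simp
      | succ s ihs =>
        intro n e
        rw [pow_succ', mul_smul, mul_smul, ← ihs, ← H.smul]
        congr 1
        push_cast
        ring_nf
    have hN : ∀ n, ∀ e ∈ LinearMap.ker (LinearMap.lsmul R E (f i ^ t)),
        π n e ∈ LinearMap.ker (LinearMap.lsmul R E (f i ^ t)) := fun n e he => by
      rw [LinearMap.mem_ker, LinearMap.lsmul_apply] at he ⊢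
      rw [← hpow, he, map_zero]
    obtain ⟨π', H'⟩ := H.submodule _ hN
    obtain ⟨π'', H''⟩ := H.quotient _ hN
    have h0'' : ∀ j ∉ insert i T, ∀ e : E ⧸ LinearMap.ker (LinearMap.lsmul R E (f i ^ t)),
        f j • e = 0 := fun j hj e => by
      obtain ⟨e, rfl⟩ := Submodule.mkQ_surjective _ e
      rw [← map_smul, h0 j hj, map_zero]
    refine EventuallyCechVanishes.of_submodule H.actsInDegreeOne _
      (hnil t _ _ π' H' (fun j hj e => Subtype.ext (h0 j hj e)) fun e => Subtype.ext e.2)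
      (eventuallyCechVanishes_of_injective H'' i ?_ (hquot _ _ π'' H'' h0''))
    refine (injective_iff_map_eq_zero _).2 fun e he => ?_
    obtain ⟨e, rfl⟩ := Submodule.mkQ_surjective _ e
    rw [LinearMap.lsmul_apply, ← map_smul, Submodule.mkQ_apply, Submodule.Quotient.mk_eq_zero,
      LinearMap.mem_ker, LinearMap.lsmul_apply, smul_smul, ← pow_succ] at he
    rw [Submodule.mkQ_apply, Submodule.Quotient.mk_eq_zero]
    exact (ht (t + 1) (Nat.le_succ t)).ge he

end SerreVanishing

/-! ### The graded pieces of the cohomology -/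

section CohomologyDeg

variable {R : Type*} [CommRing R] {m : ℕ} {f : Fin m → R}
variable {E : Type*} [AddCommGroup E] [Module R E] {gr : ℤ → AddSubgroup E}

theorem cechCohomologyDeg_eq_bot_iff {p : ℕ} {n : ℤ} :
    cechCohomologyDeg f gr p n = ⊥ ↔
      ∀ c ∈ cechDeg f gr p n, cechD f E p c = 0 → c ∈ cechCoboundaries f E p := by
  rw [eq_bot_iff]
  constructor
  · intro h c hc hd
    have h1 := h ⟨⟨c, hd⟩, hc, rfl⟩
    exact (Submodule.Quotient.mk_eq_zero
      ((cechCoboundaries f E p).comap (LinearMap.ker (cechD f E p)).subtype)).1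
      (AddSubgroup.mem_bot.1 h1)
  · rintro h _ ⟨⟨c, hd⟩, hc, rfl⟩
    exact AddSubgroup.mem_bot.2 ((Submodule.Quotient.mk_eq_zero _).2 (h c hc hd))

theorem CechVanishes.cechCohomologyDeg_eq_bot {p : ℕ} {n : ℤ} (h : CechVanishes f gr p n) :
    cechCohomologyDeg f gr p n = ⊥ := by
  rw [cechCohomologyDeg_eq_bot_iff]
  intro c hc hd
  have h1 := h c hc hd
  cases p with
  | zero => exact (Submodule.mem_bot _).2 h1
  | succ p =>
    obtain ⟨b, _, hb⟩ := h1
    exact ⟨b, hb⟩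

theorem cechCohomologyDeg_eq_bot_of_lt {p : ℕ} (hp : m < p) (n : ℤ) :
    cechCohomologyDeg f gr p n = ⊥ := by
  have : IsEmpty (Fin p ↪o Fin m) :=
    ⟨fun σ => by simpa using hp.not_ge (by simpa using Fintype.card_le_of_injective σ σ.injective)⟩
  rw [cechCohomologyDeg_eq_bot_iff]
  intro c _ _
  rw [Subsingleton.elim c 0]
  exact zero_mem _

theorem IsHomogeneousCoboundary.add {p : ℕ} {n : ℤ} {c c' : CechCochain f E p}
    (h : IsHomogeneousCoboundary gr n c) (h' : IsHomogeneousCoboundary gr n c') :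
    IsHomogeneousCoboundary gr n (c + c') := by
  cases p with
  | zero =>
    change c + c' = 0
    rw [show c = 0 from h, show c' = 0 from h', add_zero]
  | succ p =>
    obtain ⟨b, hb, rfl⟩ := h
    obtain ⟨b', hb', rfl⟩ := h'
    exact ⟨b + b', add_mem hb hb', map_add _ _ _⟩

theorem IsHomogeneousCoboundary.smul {p : ℕ} {n : ℤ} {c : CechCochain f E p}
    (hd : ActsInDegreeOne f gr) {r : R} (hr : ∀ n, ∀ e ∈ gr n, r • e ∈ gr n)
    (h : IsHomogeneousCoboundary gr n c) : IsHomogeneousCoboundary gr n (r • c) := by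
  cases p with
  | zero =>
    change r • c = 0
    rw [show c = 0 from h, smul_zero]
  | succ p =>
    obtain ⟨b, hb, rfl⟩ := h
    refine ⟨r • b, mem_cechDeg.2 fun σ => ?_, map_smul _ _ _⟩
    obtain ⟨k, e, he, hk⟩ := (mem_localizationDeg_iff hd _ _ _).1 (mem_cechDeg.1 hb σ)
    exact (mem_localizationDeg_iff hd _ _ _).2 ⟨k, r • e, hr _ _ he, by
      rw [Pi.smul_apply, hk, smul_powFrac]⟩

end CohomologyDeg

/-! ### The polynomial module over the Rees algebra -/

section Rees

variable {A : Type u} [CommRing A] {I : Ideal A} (M : Type v) [AddCommGroup M] [Module A M]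
variable {m : ℕ} (x : Fin m → I)

theorem coe_reesGen_pow (i : Fin m) (s : ℕ) :
    ((reesGen x i ^ s : reesAlgebra I) : A[X]) = monomial s ((x i : A) ^ s) := by
  rw [SubmonoidClass.coe_pow, reesGen, monomial_pow, one_mul]

variable {M} in
theorem coeff_reesGen_pow_smul (i : Fin m) (s : ℕ) (e : PolynomialModule A M) (k : ℕ) :
    (reesGen x i ^ s • e).coeff k = if s ≤ k then (x i : A) ^ s • e.coeff (k - s) else 0 := by
  rw [Subalgebra.smul_def, coe_reesGen_pow, PolynomialModule.monomial_smul_apply]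

theorem adjoin_reesGen_eq_top (hx : Ideal.span (Set.range fun i => (x i : A)) = I) :
    Algebra.adjoin A (Set.range (reesGen x)) = ⊤ := by
  apply Subalgebra.map_injective (f := (reesAlgebra I).val) Subtype.val_injective
  rw [AlgHom.map_adjoin, Algebra.map_top, Subalgebra.range_val]
  refine Eq.trans ?_ (adjoin_monomial_eq_reesAlgebra I)
  have h1 : (I.restrictScalars A).map (monomial 1 : A →ₗ[A] A[X]) =
      Submodule.span A ((reesAlgebra I).val '' Set.range (reesGen x)) := by
    conv_lhs => rw [← hx]
    rw [Ideal.span, Submodule.restrictScalars_self, Submodule.map_span, ← Set.range_comp,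
      ← Set.range_comp]
    rfl
  exact (Algebra.adjoin_span (R := A)).symm.trans (congrArg _ (congrArg _ h1.symm))

/-- The degree `d` part of `M[t]`. -/
def polyDeg (A : Type u) [CommRing A] (M : Type v) [AddCommGroup M] [Module A M] (d : ℤ) :
    AddSubgroup (PolynomialModule A M) where
  carrier := {f : PolynomialModule A M | ∀ k : ℕ, (k : ℤ) ≠ d → f.coeff k = 0}
  zero_mem' := fun k _ => by simp
  add_mem' := fun {f g} hf hg k hk => by simp [hf k hk, hg k hk]
  neg_mem' := fun {f} hf k hk => neg_eq_zero.2 (hf k hk)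

/-- The projection of `M[t]` to its degree `d` part. -/
def polyProj (A : Type u) [CommRing A] (M : Type v) [AddCommGroup M] [Module A M] (d : ℤ) :
    PolynomialModule A M →ₗ[A] PolynomialModule A M where
  toFun e := .ofCoeff A (e.coeff.filter fun k : ℕ => (k : ℤ) = d)
  map_add' e e' := by
    ext k
    simp [Finsupp.filter_apply, apply_ite₂]
  map_smul' a e := by
    have hs : ∀ (e' : PolynomialModule A M) (k : ℕ), (a • e').coeff k = a • e'.coeff k :=
      fun _ _ => rfl
    ext k
    by_cases h : (k : ℤ) = d <;> simp [hs, h]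

theorem coeff_polyProj (d : ℤ) (e : PolynomialModule A M) (k : ℕ) :
    (polyProj A M d e).coeff k = if (k : ℤ) = d then e.coeff k else 0 :=
  Finsupp.filter_apply _ _ _

theorem isGradingWith_polyDeg : IsGradingWith (reesGen x) (polyDeg A M) (polyProj A M) where
  mem n e k hk := by rw [coeff_polyProj, if_neg hk]
  eq_self {n e} he := by
    ext k
    rw [coeff_polyProj]
    split_ifs with h
    · rfl
    · exact (he k h).symm
  eq_zero {n k e} hnk he := by
    ext l
    rw [coeff_polyProj]
    split_ifs with h
    · exact he l (h ▸ hnk)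
    · rfl
  exists_sum e := by
    refine ⟨e.coeff.support.map Nat.castEmbedding, ?_⟩
    ext k
    rw [PolynomialModule.coeff_sum, Finsupp.finsetSum_apply, Finset.sum_map]
    simp only [coeff_polyProj, Nat.castEmbedding_apply, Nat.cast_inj]
    rw [Finset.sum_ite_eq]
    simp [eq_comm]
  smul n i e := by
    ext k
    have h := coeff_reesGen_pow_smul (M := M) x i 1
    simp only [pow_one] at h
    rw [coeff_polyProj, h, h, coeff_polyProj]
    rcases k with _ | k
    · simp
    · simp

end Rees

/-! ### Vanishing of the cohomology of `M[t]` below the grade -/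

section Cancellation

variable {A : Type*} [CommRing A] {R : Type*} [CommRing R] [Algebra A R] {m : ℕ} {f : Fin m → R}
variable {E : Type w} [AddCommGroup E] [Module R E] [Module A E] [IsScalarTower A R E]
variable {gr : ℤ → AddSubgroup E} {π : ℤ → E →ₗ[A] E}

theorem IsGradingWith.algebraMap_smul_mem (H : IsGradingWith f gr π) (a : A) {n : ℤ} {e : E}
    (he : e ∈ gr n) : algebraMap A R a • e ∈ gr n := by
  rw [algebraMap_smul, ← H.eq_self he, ← map_smul]
  exact H.mem _ _

theorem cechMap_apply_of_forall_eq_smul {p : ℕ} {φ : E →ₗ[R] E} {r : R} (h : ∀ e, φ e = r • e)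
    (c : CechCochain f E p) : cechMap f φ p c = r • c := by
  funext σ
  obtain ⟨e, k, hk⟩ := exists_powFrac _ (c σ)
  rw [cechMap_apply, Pi.smul_apply, hk, smul_powFrac, locMap_powFrac, h]

/-- If multiplication by an injective degree `1` map `T` is bijective in degrees `≥ 0`, then `T` can
be cancelled in the strands of degree `≥ 0`. -/
theorem isHomogeneousCoboundary_of_cechMap (hd : ActsInDegreeOne f gr) {T : E →ₗ[R] E}
    (hses : GradedShortExact T (LinearMap.range T).mkQ (fun k => gr (k - 1)) gr
      (fun n => (gr n).map (LinearMap.range T).mkQ.toAddMonoidHom))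
    (hT : ∀ n : ℤ, 0 < n → ∀ e ∈ gr n, e ∈ LinearMap.range T) {p : ℕ} {n : ℤ}
    (hn : 0 ≤ n) {c : CechCochain f E p}
    (hc : IsHomogeneousCoboundary gr (n + 1) (cechMap f T p c)) :
    IsHomogeneousCoboundary gr n c := by
  refine isHomogeneousCoboundary_shift hd
    (hses.isHomogeneousCoboundary_of_map hd (fun q _ b hb _ => ?_) hc)
  have hd' := hses.actsInDegreeOne_right hd
  have hb0 : b = 0 := by
    funext σ
    obtain ⟨k, _, ⟨e, he, rfl⟩, hk⟩ := (mem_localizationDeg_iff hd' _ _ _).1 (mem_cechDeg.1 hb σ)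
    have h0 : (LinearMap.range T).mkQ e = 0 := by
      rw [Submodule.mkQ_apply, Submodule.Quotient.mk_eq_zero]
      have h1 : (0 : ℤ) ≤ k * q := by positivity
      exact hT _ (by lia) e he
    rw [hk]
    exact (congrArg (powFrac _ · k) h0).trans (powFrac_zero _ _)
  rw [hb0]
  exact isHomogeneousCoboundary_zero _ _

/-- If `f_i` acts as `r` followed by `T`, then `f_i^s` may be replaced by `r^s` in degrees `≥ 0`. -/
theorem isHomogeneousCoboundary_pow_smul (hd : ActsInDegreeOne f gr) {T : E →ₗ[R] E}
    (hses : GradedShortExact T (LinearMap.range T).mkQ (fun k => gr (k - 1)) gr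
      (fun n => (gr n).map (LinearMap.range T).mkQ.toAddMonoidHom))
    (hT : ∀ n : ℤ, 0 < n → ∀ e ∈ gr n, e ∈ LinearMap.range T) {i : Fin m} {r : R}
    (hf : ∀ e : E, f i • e = T (r • e)) {p : ℕ} {n : ℤ} (hn : 0 ≤ n) (s : ℕ)
    (c : CechCochain f E p) (hc : IsHomogeneousCoboundary gr (n + s) (f i ^ s • c)) :
    IsHomogeneousCoboundary gr n (r ^ s • c) := by
  induction s generalizing c with
  | zero => simpa using hc
  | succ s ih =>
    rw [pow_succ, mul_smul]
    refine ih _ (isHomogeneousCoboundary_of_cechMap hd hses hT (by lia) ?_)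
    have h1 : cechMap f T p (r • (f i ^ s • c)) = f i • (f i ^ s • c) := by
      rw [← cechMap_apply_of_forall_eq_smul (φ := T ∘ₗ LinearMap.lsmul R E r)
        fun e => (hf e).symm, ← cechMap_apply_of_forall_eq_smul (φ := LinearMap.lsmul R E r)
        fun e => rfl]
      funext σ
      obtain ⟨e, k, hk⟩ := exists_powFrac _ ((f i ^ s • c) σ)
      simp only [cechMap_apply, hk, locMap_powFrac, LinearMap.comp_apply]
    rw [smul_comm, h1, smul_smul, ← pow_succ', add_assoc]
    exact_mod_cast hc

/-- Suppose that multiplication by `f_i` is multiplication by `x_i ∈ A` followed by a map `T` as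
above. Then the cohomology classes of degree `≥ 0` are killed by powers of the elements of the ideal
`(x_1, …, x_m)`; so they vanish when such an element `y` is regular on `E` and the cohomology of
`E / yE` vanishes. -/
theorem cechVanishes_of_regular (H : IsGradingWith f gr π) {T : E →ₗ[R] E}
    (hses : GradedShortExact T (LinearMap.range T).mkQ (fun k => gr (k - 1)) gr
      (fun n => (gr n).map (LinearMap.range T).mkQ.toAddMonoidHom))
    (hT : ∀ n : ℤ, 0 < n → ∀ e ∈ gr n, e ∈ LinearMap.range T) {x : Fin m → A}
    (hf : ∀ i, ∀ e : E, f i • e = T (algebraMap A R (x i) • e)) {y : A}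
    (hy : y ∈ Ideal.span (Set.range x)) {E'' : Type*} [AddCommGroup E''] [Module R E'']
    {ψ : E →ₗ[R] E''} {gr'' : ℤ → AddSubgroup E''}
    (hsesy : GradedShortExact (LinearMap.lsmul R E (algebraMap A R y)) ψ gr gr gr'')
    {p : ℕ} {n : ℤ} (hn : 0 ≤ n) (h'' : ∀ q, p = q + 1 → CechVanishes f gr'' q n) :
    CechVanishes f gr p n := by
  intro c hc hdc
  have hd := H.actsInDegreeOne
  -- The annihilator of the class of `c`.
  let 𝔟 : Ideal A :=
    { carrier := {a | IsHomogeneousCoboundary gr n (algebraMap A R a • c)}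
      zero_mem' := by
        simp only [Set.mem_ofPred_eq, map_zero, zero_smul]
        exact isHomogeneousCoboundary_zero n p
      add_mem' := fun {a b} ha hb => by
        simp only [Set.mem_ofPred_eq, map_add, add_smul] at ha hb ⊢
        exact ha.add hb
      smul_mem' := fun a b hb => by
        simp only [Set.mem_ofPred_eq, smul_eq_mul, map_mul, mul_smul] at hb ⊢
        exact hb.smul hd fun n e he => H.algebraMap_smul_mem a he }
  have hI : Ideal.span (Set.range x) ≤ 𝔟.radical := by
    rw [Ideal.span_le]
    rintro _ ⟨i, rfl⟩
    obtain ⟨s, hs⟩ := exists_pow_smul_isHomogeneousCoboundary hd hc hdc i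
    have h1 := isHomogeneousCoboundary_pow_smul hd hses hT (hf i) hn s c hs
    rw [← map_pow] at h1
    exact ⟨s, h1⟩
  obtain ⟨K, hK⟩ := hI hy
  change IsHomogeneousCoboundary _ _ _ at hK
  rw [map_pow] at hK
  clear hI hdc hc
  induction K with
  | zero => simpa using hK
  | succ K ihK =>
    refine ihK (hsesy.isHomogeneousCoboundary_of_map hd h'' ?_)
    rwa [cechMap_apply_of_forall_eq_smul (r := algebraMap A R y) fun e => rfl, smul_smul,
      ← pow_succ']

end Cancellation

section PolynomialCohomology

variable {A : Type u} [CommRing A] {I : Ideal A}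
variable {m : ℕ} (x : Fin m → I)

theorem single_coeff_of_mem_polyDeg {M : Type v} [AddCommGroup M] [Module A M] {d : ℤ}
    {e : PolynomialModule A M} (he : e ∈ polyDeg A M d) {k : ℕ} (hk : (k : ℤ) = d) :
    PolynomialModule.single A k (e.coeff k) = e := by
  ext l
  rw [PolynomialModule.coeff_single]
  by_cases h : k = l
  · subst h
    rw [Finsupp.single_eq_same]
  · rw [Finsupp.single_eq_of_ne' h, he l (by lia)]

variable (I) in
/-- Multiplication by `t` on `M[t]`, as a map of modules over the Rees ring. -/
def mulT (M : Type v) [AddCommGroup M] [Module A M] :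
    PolynomialModule A M →ₗ[reesAlgebra I] PolynomialModule A M :=
  (LinearMap.lsmul A[X] (PolynomialModule A M) Polynomial.X).restrictScalars (reesAlgebra I)

theorem mulT_single (M : Type v) [AddCommGroup M] [Module A M] (k : ℕ) (a : M) :
    mulT I M (PolynomialModule.single A k a) = PolynomialModule.single A (k + 1) a := by
  change (X : A[X]) • PolynomialModule.single A k a = _
  rw [← monomial_one_one_eq_X, PolynomialModule.monomial_smul_single, one_smul, add_comm]

theorem coeff_mulT {M : Type v} [AddCommGroup M] [Module A M] (e : PolynomialModule A M) (k : ℕ) :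
    (mulT I M e).coeff k = if 1 ≤ k then e.coeff (k - 1) else 0 := by
  change ((X : A[X]) • e).coeff k = _
  rw [← monomial_one_one_eq_X, PolynomialModule.monomial_smul_apply, one_smul]

/-- `0 → M[t](-1) → M[t] → M → 0`, the first map being the multiplication by `t`. -/
theorem gradedShortExact_mulT (M : Type v) [AddCommGroup M] [Module A M] :
    GradedShortExact (mulT I M) (LinearMap.range (mulT I M)).mkQ (fun k => polyDeg A M (k - 1))
      (polyDeg A M)
      (fun n => (polyDeg A M n).map (LinearMap.range (mulT I M)).mkQ.toAddMonoidHom) where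
  injective := (injective_iff_map_eq_zero _).2 fun e he => by
    ext k
    have h := coeff_mulT (I := I) e (k + 1)
    rw [he] at h
    simpa using h.symm
  exact := LinearMap.exact_map_mkQ_range _
  map_mem_iff := fun {n e} => by
    constructor
    · intro h k hk
      have := h (k + 1) (by push_cast; lia)
      rwa [coeff_mulT, if_pos (Nat.le_add_left _ _), Nat.add_sub_cancel] at this
    · intro h k hk
      rw [coeff_mulT]
      split_ifs with h1
      · exact h (k - 1) (by lia)
      · rfl
  map_mem := fun he => ⟨_, he, rfl⟩
  exists_lift := fun ⟨e, he, h⟩ => ⟨e, he, h⟩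

theorem algebraMap_smul_coeff {M : Type v} [AddCommGroup M] [Module A M] (a : A)
    (e : PolynomialModule A M) (k : ℕ) :
    (algebraMap A (reesAlgebra I) a • e).coeff k = a • e.coeff k := by
  rw [algebraMap_smul]
  rfl

theorem reesGen_smul {M : Type v} [AddCommGroup M] [Module A M] (i : Fin m)
    (e : PolynomialModule A M) :
    reesGen x i • e = mulT I M (algebraMap A (reesAlgebra I) (x i) • e) := by
  ext k
  have h := coeff_reesGen_pow_smul x i 1 e k
  rw [pow_one, pow_one] at h
  rw [h, coeff_mulT, algebraMap_smul_coeff]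

/-- The map `M[t] → M'[t]` induced by `M → M'`, as a map of modules over the Rees ring. -/
def polyMap (I : Ideal A) {M M' : Type v} [AddCommGroup M] [Module A M] [AddCommGroup M']
    [Module A M'] (φ : M →ₗ[A] M') :
    PolynomialModule A M →ₗ[reesAlgebra I] PolynomialModule A M' where
  toFun := PolynomialModule.map A φ
  map_add' := map_add _
  map_smul' r e := by
    have h := PolynomialModule.map_smul A φ (r : A[X]) e
    rw [Algebra.algebraMap_self, Polynomial.map_id] at h
    exact h

theorem coeff_polyMap {M M' : Type v} [AddCommGroup M] [Module A M] [AddCommGroup M']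
    [Module A M'] (φ : M →ₗ[A] M') (e : PolynomialModule A M) (k : ℕ) :
    (polyMap I φ e).coeff k = φ (e.coeff k) := rfl

open scoped Pointwise in
theorem gradedShortExact_polyMap {M : Type v} [AddCommGroup M] [Module A M] {y : A}
    (hy : IsSMulRegular M y) :
    GradedShortExact (LinearMap.lsmul (reesAlgebra I) (PolynomialModule A M)
        (algebraMap A (reesAlgebra I) y))
      (polyMap I (y • (⊤ : Submodule A M)).mkQ) (polyDeg A M) (polyDeg A M)
      (polyDeg A (QuotSMulTop y M)) where
  injective := (injective_iff_map_eq_zero _).2 fun e he => by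
    ext k
    have h := congrArg (fun e => e.coeff k) he
    simp only [LinearMap.lsmul_apply, algebraMap_smul_coeff, PolynomialModule.coeff_zero,
      Finsupp.coe_zero, Pi.zero_apply] at h
    exact hy (h.trans (smul_zero y).symm)
  exact := fun e => by
    constructor
    · intro he
      have hk : ∀ k, ∃ u, y • u = e.coeff k ∧ (e.coeff k = 0 → u = 0) := fun k => by
        have h := congrArg (fun e => e.coeff k) he
        rw [coeff_polyMap, Submodule.mkQ_apply] at h
        obtain ⟨u, -, hu⟩ := (Submodule.Quotient.mk_eq_zero _).1 h
        refine ⟨u, hu, fun h0 => hy ?_⟩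
        rw [h0] at hu
        exact hu.trans (smul_zero y).symm
      choose u hu hu0 using hk
      refine ⟨.ofCoeff A (Finsupp.onFinset e.coeff.support u fun k hk =>
        Finsupp.mem_support_iff.2 fun h => hk (hu0 k h)), ?_⟩
      ext k
      rw [LinearMap.lsmul_apply, algebraMap_smul_coeff]
      exact hu k
    · rintro ⟨e, rfl⟩
      ext k
      rw [coeff_polyMap, LinearMap.lsmul_apply, algebraMap_smul_coeff, Submodule.mkQ_apply]
      exact (Submodule.Quotient.mk_eq_zero _).2
        (Submodule.smul_mem_pointwise_smul _ y _ Submodule.mem_top)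
  map_mem_iff := fun {n e} => by
    refine forall_congr' fun k => forall_congr' fun _ => ?_
    rw [LinearMap.lsmul_apply, algebraMap_smul_coeff]
    exact ⟨fun h => hy (h.trans (smul_zero y).symm), fun h => by rw [h, smul_zero]⟩
  map_mem := fun he k hk => by rw [coeff_polyMap, he k hk, map_zero]
  exists_lift := fun {n e} he => by
    by_cases hn : 0 ≤ n
    · obtain ⟨k, rfl⟩ := Int.eq_ofNat_of_zero_le hn
      obtain ⟨a, ha⟩ := Submodule.mkQ_surjective _ (e.coeff k)
      refine ⟨PolynomialModule.single A k a, fun l hl => ?_, ?_⟩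
      · rw [PolynomialModule.coeff_single, Finsupp.single_eq_of_ne' (by lia)]
      · rw [← single_coeff_of_mem_polyDeg he rfl, ← ha]
        exact PolynomialModule.map_single _ _ _ _
    · refine ⟨0, zero_mem _, ?_⟩
      rw [map_zero]
      ext k
      exact (he k (by lia)).symm

/-- `H^p(M[t])_n = 0` for `n ≥ 0` and `p < grade(I, M)`: cohomology classes are killed by a power
of `I`, on which an `M`-regular element `y ∈ I` is injective by induction. -/
theorem cechVanishes_polyDeg (hx : Ideal.span (Set.range fun i => (x i : A)) = I) (rs : List A) :
    ∀ (M : Type v) [AddCommGroup M] [Module A M] (_ : ∀ r ∈ rs, r ∈ I)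
      (_ : RingTheory.Sequence.IsWeaklyRegular M rs) (p : ℕ) (_ : p < rs.length) (n : ℤ)
      (_ : 0 ≤ n), CechVanishes (reesGen x) (polyDeg A M) p n := by
  induction rs with
  | nil =>
    intro M _ _ _ _ p hp
    exact absurd hp (Nat.not_lt_zero p)
  | cons y rs ih =>
    intro M _ _ hmem hreg p hp n hn
    rw [RingTheory.Sequence.isWeaklyRegular_cons_iff] at hreg
    refine cechVanishes_of_regular (isGradingWith_polyDeg M x) (gradedShortExact_mulT M)
      (fun k hk e he => ?_) (reesGen_smul x) (hx.symm ▸ hmem y (by simp))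
      (gradedShortExact_polyMap (I := I) hreg.1) hn fun q hq =>
        ih _ (fun r hr => hmem r (by simp [hr])) hreg.2 q (by rw [List.length_cons] at hp; lia) n hn
    obtain ⟨l, rfl⟩ : ∃ l : ℕ, k = (l + 1 : ℕ) := ⟨(k - 1).toNat, by lia⟩
    exact ⟨PolynomialModule.single A l (e.coeff (l + 1)), by
      rw [mulT_single, single_coeff_of_mem_polyDeg he rfl]⟩

end PolynomialCohomology

/-! ### Finiteness of the amplitude -/

section Finiteness

variable {A : Type u} [CommRing A] {I : Ideal A} (M : Type v) [AddCommGroup M] [Module A M]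
variable {m : ℕ} (x : Fin m → I)

theorem lSubmodule_fg [IsNoetherianRing A] [Module.Finite A M] : (lSubmodule I M).FG := by
  let F : I.Filtration M := I.stableFiltration (I • (⊤ : Submodule A M))
  have hF : lSubmodule I M = F.submodule := by
    ext e
    refine forall_congr' fun n => ?_
    change _ ∈ I ^ (n + 1) • (⊤ : Submodule A M) ↔ _ ∈ I ^ n • I • (⊤ : Submodule A M)
    rw [pow_succ, Submodule.mul_smul]
  rw [hF]
  exact (F.submodule_fg_iff_stable fun i => IsNoetherian.noetherian _).2
    (I.stableFiltration_stable _)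

/-- `H^i(L^I(M))_n = 0` for `i < grade(I, M)` and `n ≫ 0`: in the sequence
`0 → ⨁ I^{n+1}M → M[t] → L^I(M) → 0` the kernel is finitely generated over the Rees ring. -/
theorem exists_forall_ge_lCohomologyDeg_eq_bot [IsNoetherianRing A] [Module.Finite A M]
    (hx : Ideal.span (Set.range fun i => (x i : A)) = I) {i : ℕ} (hi : (i : ℕ∞) < moduleGrade I M) :
    ∃ n₀ : ℤ, ∀ n ≥ n₀, lCohomologyDeg M x i n = ⊥ := by
  obtain ⟨rs, hrs⟩ := lt_iSup_iff.1 hi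
  obtain ⟨⟨hmem, hreg⟩, hlen⟩ := lt_iSup_iff.1 hrs
  have hL : IsNoetherian (reesAlgebra I) (lSubmodule I M) :=
    isNoetherian_of_fg_of_noetherian _ (lSubmodule_fg M)
  have H := isGradingWith_polyDeg M x
  obtain ⟨π', H'⟩ := H.submodule (lSubmodule I M) fun n e he k => by
    rw [coeff_polyProj]
    split_ifs
    · exact he k
    · exact zero_mem _
  obtain ⟨n₀, hn₀⟩ := eventuallyCechVanishes_of_support (adjoin_reesGen_eq_top x hx) Finset.univ
    (lSubmodule I M) _ π' H' (fun j hj => absurd (Finset.mem_univ j) hj) (i + 1)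
  refine ⟨max n₀ 0, fun n hn => ?_⟩
  exact ((gradedShortExact_mkQ (lSubmodule I M) (polyDeg A M)).cechVanishes_right H.actsInDegreeOne
    (cechVanishes_polyDeg x hx rs M hmem hreg i (by exact_mod_cast hlen) n
      (le_trans (le_max_right _ _) hn))
    (hn₀ n (le_trans (le_max_left _ _) hn))).cechCohomologyDeg_eq_bot

theorem lCohomologyDeg_eq_bot_of_lt {i : ℕ} (hi : m < i) (n : ℤ) : lCohomologyDeg M x i n = ⊥ :=
  cechCohomologyDeg_eq_bot_of_lt (f := reesGen x) (gr := lModuleDeg I M) hi n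

/-- The amplitude is finite: by the definition of `ξ_I(M)` it involves only finitely many negative
degrees for each `i < ξ_I(M)`. -/
theorem amplitude_lt_top [IsNoetherianRing A] [Module.Finite A M]
    (hx : Ideal.span (Set.range fun i => (x i : A)) = I) : amplitude M x < ⊤ := by
  have key : ∀ i : ℕ, ∃ B : ℕ, (i : ℕ∞) < xiInvariant M x →
      ∀ n : ℤ, lCohomologyDeg M x i (n - 1) ≠ ⊥ → n.natAbs ≤ B := fun i => by
    by_cases hi : (i : ℕ∞) < xiInvariant M x
    · have hg : (i : ℕ∞) < moduleGrade I M := lt_of_lt_of_le hi (min_le_left _ _)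
      obtain ⟨n₀, hn₀⟩ := exists_forall_ge_lCohomologyDeg_eq_bot M x hx hg
      have hfin : {j : ℤ | j < 0 ∧ lCohomologyDeg M x i j ≠ ⊥}.Finite := by
        by_contra hinf
        refine (lt_irrefl (i : ℕ∞)) (lt_of_lt_of_le hi ?_)
        exact (min_le_right _ _).trans (iInf₂_le i ⟨hg, Or.inr hinf⟩)
      obtain ⟨b, hb⟩ := hfin.bddBelow
      refine ⟨n₀.natAbs + b.natAbs + 1, fun _ n hn => ?_⟩
      have h1 : n - 1 < n₀ := lt_of_not_ge fun h => hn (hn₀ _ h)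
      by_cases h0 : n - 1 < 0
      · have h2 : b ≤ n - 1 := hb ⟨h0, hn⟩
        clear hn
        omega
      · clear hn
        omega
    · exact ⟨0, fun h => absurd h hi⟩
  choose B hB using key
  refine lt_of_le_of_lt (b := ((∑ i ∈ Finset.range (m + 1), B i : ℕ) : ℕ∞)) ?_
    (ENat.natCast_lt_top _)
  refine iSup₂_le fun n ⟨i, hi, hn⟩ => ?_
  have him : i ≤ m := by
    by_contra h
    exact hn (lCohomologyDeg_eq_bot_of_lt M x (not_le.1 h) _)
  exact_mod_cast (hB i hi n hn).trans
    (Finset.single_le_sum (f := B) (fun _ _ => Nat.zero_le _) (Finset.mem_range.2 (by omega)))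

end Finiteness

/-! ### Grade at most two and systems of equations -/

section Grade

variable {R : Type*} [CommRing R] {E : Type*} [AddCommGroup E] [Module R E] {m : ℕ}

theorem exists_isSMulRegular_of_one_le_moduleGrade {𝔞 : Ideal R} (h : 1 ≤ moduleGrade 𝔞 E) :
    ∃ a ∈ 𝔞, IsSMulRegular E a := by
  obtain ⟨rs, hrs⟩ := lt_iSup_iff.1 (lt_of_lt_of_le zero_lt_one h)
  obtain ⟨⟨hmem, hreg⟩, hlen⟩ := lt_iSup_iff.1 hrs
  match rs, hlen with
  | a :: rs, _ =>
    rw [RingTheory.Sequence.isWeaklyRegular_cons_iff] at hreg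
    exact ⟨a, hmem a (by simp), hreg.1⟩

theorem exists_isSMulRegular_pair_of_two_le_moduleGrade {𝔞 : Ideal R} (h : 2 ≤ moduleGrade 𝔞 E) :
    ∃ a ∈ 𝔞, ∃ b ∈ 𝔞, IsSMulRegular E a ∧ IsSMulRegular (QuotSMulTop a E) b := by
  obtain ⟨rs, hrs⟩ := lt_iSup_iff.1 (lt_of_lt_of_le (by norm_num : (1 : ℕ∞) < 2) h)
  obtain ⟨⟨hmem, hreg⟩, hlen⟩ := lt_iSup_iff.1 hrs
  match rs, hlen with
  | [a], h => simp at h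
  | a :: b :: rs, _ =>
    rw [RingTheory.Sequence.isWeaklyRegular_cons_iff,
      RingTheory.Sequence.isWeaklyRegular_cons_iff] at hreg
    exact ⟨a, hmem a (by simp), b, hmem b (by simp), hreg.1, hreg.2.1⟩

theorem one_le_moduleGrade {𝔞 : Ideal R} {a : R} (ha : a ∈ 𝔞) (hreg : IsSMulRegular E a) :
    1 ≤ moduleGrade 𝔞 E :=
  le_iSup₂_of_le [a] ⟨by simpa using ha, by
    rwa [RingTheory.Sequence.isWeaklyRegular_singleton_iff]⟩ (by simp)

theorem two_le_moduleGrade {𝔞 : Ideal R} {a b : R} (ha : a ∈ 𝔞) (hb : b ∈ 𝔞)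
    (hreg : IsSMulRegular E a) (hreg' : IsSMulRegular (QuotSMulTop a E) b) :
    2 ≤ moduleGrade 𝔞 E :=
  le_iSup₂_of_le [a, b] ⟨by simpa using ⟨ha, hb⟩, by
    rw [RingTheory.Sequence.isWeaklyRegular_cons_iff,
      RingTheory.Sequence.isWeaklyRegular_singleton_iff]
    exact ⟨hreg, hreg'⟩⟩ (by simp)

/-- Prime avoidance: if no nonzero element is killed by all the `f_i`, then the ideal contains an
element outside all the associated primes. -/
theorem exists_isSMulRegular_of_forall [IsNoetherianRing R] [Module.Finite R E] {𝔞 : Ideal R}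
    {f : Fin m → R} (hf : ∀ i, f i ∈ 𝔞) (h0 : ∀ u : E, (∀ i, f i • u = 0) → u = 0) :
    ∃ a ∈ 𝔞, IsSMulRegular E a := by
  by_contra! hcon
  have hsub : (𝔞 : Set R) ⊆ ⋃ p ∈ associatedPrimes R E, (p : Set R) := by
    rw [biUnion_associatedPrimes_eq_compl_regular]
    exact fun a ha => hcon a ha
  have hfin := associatedPrimes.finite R E
  rw [Ideal.subset_union_prime_finite hfin ⊥ ⊥ fun p hp _ _ => IsAssociatedPrime.isPrime hp] at hsub
  obtain ⟨p, hp, hle⟩ := hsub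
  have hprime := IsAssociatedPrime.isPrime hp
  obtain ⟨-, z, hz⟩ := isAssociatedPrime_iff.1 hp
  have hz0 : z = 0 := h0 z fun i => by
    have h1 : f i ∈ p := hle (hf i)
    rw [hz] at h1
    simpa [Submodule.mem_colon_singleton] using h1
  refine hprime.ne_top ((Ideal.eq_top_iff_one _).2 ?_)
  rw [hz, hz0]
  simp [Submodule.mem_colon_singleton]

/-- The vanishing of `H^0` and `H^1` implies that the grade is at least `2`. -/
theorem two_le_moduleGrade_of_forall [IsNoetherianRing R] [Module.Finite R E] {𝔞 : Ideal R}
    {f : Fin m → R} (hf : ∀ i, f i ∈ 𝔞)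
    (h0 : ∀ (u : E) (s : ℕ), (∀ i, f i ^ s • u = 0) → u = 0)
    (h1 : ∀ e : Fin m → E, (∀ i j, f j • e i = f i • e j) →
      ∃ (v : E) (s : ℕ), ∀ i, f i ^ s • (f i • v - e i) = 0) :
    2 ≤ moduleGrade 𝔞 E := by
  have h0' : ∀ u : E, (∀ i, f i • u = 0) → u = 0 := fun u hu => h0 u 1 (by simpa using hu)
  obtain ⟨a, ha, hreg⟩ := exists_isSMulRegular_of_forall hf h0'
  obtain ⟨b, hb, hreg'⟩ := exists_isSMulRegular_of_forall (E := QuotSMulTop a E) hf fun u hu => by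
    obtain ⟨u, rfl⟩ := Submodule.mkQ_surjective _ u
    have key : ∀ i, ∃ e : E, a • e = f i • u := fun i => by
      have h2 := hu i
      rw [← map_smul, Submodule.mkQ_apply, Submodule.Quotient.mk_eq_zero] at h2
      obtain ⟨e, -, he⟩ := h2
      exact ⟨e, he⟩
    choose e he using key
    obtain ⟨v, s, hv⟩ := h1 e fun i j => hreg (by
      change a • f j • e i = a • f i • e j
      rw [smul_comm a, he, smul_comm a, he, smul_comm])
    have huv : a • v - u = 0 := h0 _ (s + 1) fun i => by
      have h3 : f i • (a • v - u) = a • (f i • v - e i) := by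
        rw [smul_sub, smul_sub, he, smul_comm]
      rw [pow_succ, mul_smul, h3, smul_comm, hv, smul_zero]
    rw [Submodule.mkQ_apply, Submodule.Quotient.mk_eq_zero, ← sub_eq_zero.1 huv]
    exact Submodule.smul_mem_pointwise_smul _ a _ Submodule.mem_top
  exact two_le_moduleGrade ha hb hreg hreg'

theorem smul_eq_zero_of_mem_span {f : Fin m → R} {u : E} (hu : ∀ i, f i • u = 0) {a : R}
    (ha : a ∈ Ideal.span (Set.range f)) : a • u = 0 := by
  obtain ⟨c, rfl⟩ := Ideal.mem_span_range_iff_exists_fun.1 ha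
  rw [Finset.sum_smul]
  exact Finset.sum_eq_zero fun i _ => by rw [mul_smul, hu, smul_zero]

theorem radical_span_le_radical_span_pow (f : Fin m → R) (N : ℕ) :
    (Ideal.span (Set.range f)).radical ≤ (Ideal.span (Set.range fun i => f i ^ N)).radical := by
  rw [Ideal.radical_le_radical_iff, Ideal.span_le]
  rintro _ ⟨i, rfl⟩
  exact ⟨N, Ideal.subset_span ⟨i, rfl⟩⟩

theorem eq_zero_of_one_le_moduleGrade {𝔞 : Ideal R} (h : 1 ≤ moduleGrade 𝔞 E) {f : Fin m → R}
    (hf : 𝔞 ≤ (Ideal.span (Set.range f)).radical) {u : E} (hu : ∀ i, f i • u = 0) : u = 0 := by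
  obtain ⟨a, ha, hreg⟩ := exists_isSMulRegular_of_one_le_moduleGrade h
  obtain ⟨K, hK⟩ := hf ha
  exact (hreg.pow K) ((smul_eq_zero_of_mem_span hu hK).trans (smul_zero _).symm)

/-- If `a, b` is a regular sequence, then so are their powers, in the form that `b^L u ∈ a^K E`
implies `u ∈ a^K E`. -/
theorem exists_eq_pow_smul {a b : R} (ha : IsSMulRegular E a)
    (hb : IsSMulRegular (QuotSMulTop a E) b) (L K : ℕ) :
    ∀ u w : E, b ^ L • u = a ^ K • w → ∃ v, u = a ^ K • v := by
  induction K with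
  | zero => exact fun u _ _ => ⟨u, by simp⟩
  | succ K ih =>
    intro u w h
    have h1 : (Submodule.Quotient.mk u : QuotSMulTop a E) = 0 := by
      refine (hb.pow L) ?_
      change b ^ L • _ = b ^ L • (0 : QuotSMulTop a E)
      rw [smul_zero, ← Submodule.Quotient.mk_smul, Submodule.Quotient.mk_eq_zero, h, pow_succ',
        mul_smul]
      exact Submodule.smul_mem_pointwise_smul _ a _ Submodule.mem_top
    obtain ⟨u', -, rfl⟩ := (Submodule.Quotient.mk_eq_zero _).1 h1
    obtain ⟨v, rfl⟩ := ih u' w (ha (by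
      change a • b ^ L • u' = a • a ^ K • w
      rw [smul_comm, smul_smul a, ← pow_succ']
      exact h))
    exact ⟨v, by
      change a • a ^ K • v = _
      rw [smul_smul, ← pow_succ']⟩

/-- If the grade is at least `2`, then `H^1` vanishes: compatible systems are solvable. Powers of a
regular pair `a, b` lie in `(f_1, …, f_m)`, so that `a^K e_i = f_i e'` and `b^L e_i = f_i e''` are
solvable; then `b^L e' = a^K e''`, and `e'` is divisible by `a^K`. -/
theorem exists_smul_eq_of_two_le_moduleGrade {𝔞 : Ideal R} (h : 2 ≤ moduleGrade 𝔞 E)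
    {f : Fin m → R} (hf : 𝔞 ≤ (Ideal.span (Set.range f)).radical) {e : Fin m → E}
    (he : ∀ i j, f j • e i = f i • e j) : ∃ v, ∀ i, f i • v = e i := by
  obtain ⟨a, ha, b, hb, hreg, hreg'⟩ := exists_isSMulRegular_pair_of_two_le_moduleGrade h
  obtain ⟨K, hK⟩ := hf ha
  obtain ⟨L, hL⟩ := hf hb
  have key : ∀ r ∈ Ideal.span (Set.range f), ∃ v, ∀ j, f j • v = r • e j := fun r hr => by
    obtain ⟨c, rfl⟩ := Ideal.mem_span_range_iff_exists_fun.1 hr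
    refine ⟨∑ i, c i • e i, fun j => ?_⟩
    rw [Finset.smul_sum, Finset.sum_smul]
    exact Finset.sum_congr rfl fun i _ => by rw [smul_comm, he, mul_smul]
  obtain ⟨v', hv'⟩ := key _ hK
  obtain ⟨v'', hv''⟩ := key _ hL
  have h1 : b ^ L • v' - a ^ K • v'' = 0 := by
    refine (hreg.pow K) ((smul_eq_zero_of_mem_span (fun i => ?_) hK).trans (smul_zero _).symm)
    rw [smul_sub, smul_comm (f i), hv', smul_comm (f i), hv'', smul_comm, sub_self]
  obtain ⟨v, rfl⟩ := exists_eq_pow_smul hreg hreg' L K v' v'' (sub_eq_zero.1 h1)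
  refine ⟨v, fun i => (hreg.pow K) ?_⟩
  change a ^ K • _ = a ^ K • _
  rw [← hv', smul_comm]

/-- The unit ideal has infinite grade, since `1` is weakly regular on every module. -/
theorem two_le_moduleGrade_top : 2 ≤ moduleGrade (⊤ : Ideal R) E :=
  two_le_moduleGrade (a := 1) (b := 1) trivial trivial (IsSMulRegular.one E) (IsSMulRegular.one _)

end Grade

section Krull

variable {A : Type*} [CommRing A] [IsNoetherianRing A] [IsLocalRing A] {M : Type*} [AddCommGroup M]
  [Module A M] [Module.Finite A M] {m : ℕ}

/-- By Krull's intersection theorem, a linear system that is solvable modulo all powers of a proper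
ideal is solvable. -/
theorem exists_smul_eq_of_forall_pow {J : Ideal A} (hJ : J ≠ ⊤) (y : Fin m → A) (u : Fin m → M)
    (h : ∀ r : ℕ, ∃ v : M, ∀ i, u i - y i • v ∈ J ^ r • (⊤ : Submodule A M)) :
    ∃ v : M, ∀ i, y i • v = u i := by
  let φ : M →ₗ[A] Fin m → M := LinearMap.pi fun i => LinearMap.lsmul A M (y i)
  have hpi : ∀ (r : ℕ) (w : Fin m → M), (∀ i, w i ∈ J ^ r • (⊤ : Submodule A M)) →
      w ∈ J ^ r • (⊤ : Submodule A (Fin m → M)) := fun r w hw => by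
    rw [← Finset.univ_sum_single w]
    refine sum_mem fun i _ => ?_
    have h1 := Submodule.mem_map_of_mem (f := LinearMap.single A (fun _ : Fin m => M) i) (hw i)
    rw [Submodule.map_smul''] at h1
    exact Submodule.smul_mono le_rfl le_top h1
  have hu : (LinearMap.range φ).mkQ u ∈ (⨅ r : ℕ, J ^ r • (⊤ : Submodule A _)) := by
    rw [Submodule.mem_iInf]
    intro r
    obtain ⟨v, hv⟩ := h r
    have h1 := Submodule.mem_map_of_mem (f := (LinearMap.range φ).mkQ) (hpi r (u - φ v) hv)
    rw [Submodule.map_smul'', map_sub, (LinearMap.exact_map_mkQ_range φ).apply_apply_eq_zero,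
      sub_zero] at h1
    exact Submodule.smul_mono le_rfl le_top h1
  rw [Ideal.iInf_pow_smul_eq_bot_of_isLocalRing J hJ, Submodule.mem_bot, Submodule.mkQ_apply,
    Submodule.Quotient.mk_eq_zero] at hu
  obtain ⟨v, hv⟩ := hu
  exact ⟨v, fun i => congrFun hv i⟩

end Krull

/-! ### The irrelevant ideal of the associated graded ring of a power -/

section Irrelevant

variable {A : Type u} [CommRing A] {I : Ideal A} {m : ℕ} (x : Fin m → I)

/-- The `n`-th powers of elements of `I`, as elements of `I ^ n`. -/
def powGen (n : ℕ) (i : Fin m) : (I ^ n : Ideal A) :=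
  ⟨(x i : A) ^ n, Ideal.pow_mem_pow (x i).2 n⟩

/-- The element `y_i t` of `G_J(A)`, of degree `1`. -/
def assocGen {J : Ideal A} (y : Fin m → J) (i : Fin m) : assocGradedRing J :=
  Ideal.Quotient.mk _ (reesGen y i)

theorem reesGen_mem_ker (J : Ideal A) (y : Fin m → J) (i : Fin m) : reesGen y i ∈
    RingHom.ker (Polynomial.constantCoeff.comp (reesAlgebra J).val.toRingHom) := by
  rw [RingHom.mem_ker]
  change (monomial 1 (y i : A)).coeff 0 = 0
  rw [coeff_monomial, if_neg one_ne_zero]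

theorem assocGen_mem_irrelevantIdeal {J : Ideal A} (y : Fin m → J) (i : Fin m) :
    assocGen y i ∈ irrelevantIdeal J :=
  Ideal.mem_map_of_mem _ (reesGen_mem_ker _ _ i)

theorem prod_monomial_one {ι : Type*} (s : Finset ι) (a : ι → A) :
    ∏ l ∈ s, monomial 1 (a l) = (monomial s.card (∏ l ∈ s, a l) : A[X]) := by
  classical
  induction s using Finset.induction_on with
  | empty => simp
  | insert l s hl ih =>
    rw [Finset.prod_insert hl, Finset.prod_insert hl, ih, monomial_mul_monomial,
      Finset.card_insert_of_notMem hl, add_comm]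

open scoped Pointwise in
/-- The `n`-th power of `x_{i_1} ⋯ x_{i_{nk}} t^k` is the product of the `x_{i_l}^n t`. -/
theorem monomial_mem_radical (hx : Ideal.span (Set.range fun i => (x i : A)) = I) {n k : ℕ}
    (hn : 0 < n) (hk : 0 < k) {a : A} (ha : a ∈ (I ^ n) ^ k) :
    ∃ h : monomial k a ∈ reesAlgebra (I ^ n),
      (⟨monomial k a, h⟩ : reesAlgebra (I ^ n)) ∈
        (Ideal.span (Set.range (reesGen (powGen x n)))).radical := by
  have ha' : a ∈ Submodule.span A ((Set.range fun i => (x i : A)) ^ (n * k)) := by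
    rw [← Submodule.span_pow, pow_mul]
    change a ∈ (Ideal.span (Set.range fun i => (x i : A)) ^ n) ^ k
    rwa [hx]
  induction ha' using Submodule.span_induction with
  | mem a haS =>
    obtain ⟨g, hg⟩ := Set.mem_pow.1 haS
    rw [List.prod_ofFn] at hg
    choose j hj using fun l => (g l).2
    refine ⟨reesAlgebra.monomial_mem.2 ha, n, ?_⟩
    have hprod : (⟨monomial k a, reesAlgebra.monomial_mem.2 ha⟩ : reesAlgebra (I ^ n)) ^ n =
        ∏ l, reesGen (powGen x n) (j l) := by
      refine Subtype.ext ?_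
      rw [SubmonoidClass.coe_pow, SubmonoidClass.coe_finsetProd, monomial_pow]
      have h1 : ∀ l, ((reesGen (powGen x n) (j l) : reesAlgebra (I ^ n)) : A[X]) =
          monomial 1 ((g l : A) ^ n) := fun l => by rw [← hj l]; rfl
      simp only [h1]
      rw [prod_monomial_one, Finset.prod_pow, hg, Finset.card_univ, Fintype.card_fin, mul_comm]
    rw [hprod]
    exact Ideal.mem_of_dvd _ (Finset.dvd_prod_of_mem _ (Finset.mem_univ ⟨0, Nat.mul_pos hn hk⟩))
      (Ideal.subset_span ⟨_, rfl⟩)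
  | zero => exact ⟨by simp, by
      have : (⟨monomial k 0, by simp⟩ : reesAlgebra (I ^ n)) = 0 := Subtype.ext (by simp)
      rw [this]
      exact zero_mem _⟩
  | add a b haS hbS iha ihb =>
    have hmem : ∀ c ∈ Submodule.span A ((Set.range fun i => (x i : A)) ^ (n * k)),
        c ∈ (I ^ n) ^ k := fun c hc => by
      rw [← Submodule.span_pow, pow_mul] at hc
      change c ∈ (Ideal.span (Set.range fun i => (x i : A)) ^ n) ^ k at hc
      rwa [hx] at hc
    obtain ⟨h1, h2⟩ := iha (hmem a haS)
    obtain ⟨h3, h4⟩ := ihb (hmem b hbS)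
    refine ⟨by rw [map_add]; exact add_mem h1 h3, ?_⟩
    convert add_mem h2 h4 using 1
    exact Subtype.ext (map_add _ _ _)
  | smul c a haS iha =>
    have hmem : a ∈ (I ^ n) ^ k := by
      rw [← Submodule.span_pow, pow_mul] at haS
      change a ∈ (Ideal.span (Set.range fun i => (x i : A)) ^ n) ^ k at haS
      rwa [hx] at haS
    obtain ⟨h1, h2⟩ := iha hmem
    refine ⟨by rw [map_smul]; exact Subalgebra.smul_mem _ h1 c, ?_⟩
    convert Ideal.mul_mem_left _ (algebraMap A (reesAlgebra (I ^ n)) c) h2 using 1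
    refine Subtype.ext ?_
    rw [← Algebra.smul_def]
    exact (map_smul (monomial k : A →ₗ[A] A[X]) c a)

/-- The elements `x_i^n t` generate `G_{I^n}(A)₊` up to radical. -/
theorem irrelevantIdeal_le_radical (hx : Ideal.span (Set.range fun i => (x i : A)) = I) {n : ℕ}
    (hn : 0 < n) :
    irrelevantIdeal (I ^ n) ≤ Ideal.radical (R := assocGradedRing (I ^ n))
      (Ideal.span (Set.range (assocGen (powGen x n)))) := by
  rw [irrelevantIdeal, Ideal.map_le_iff_le_comap]
  intro r hr
  have h0 : (r : A[X]).coeff 0 = 0 := hr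
  have hr' : r ∈ (Ideal.span (Set.range (reesGen (powGen x n)))).radical := by
    have hsum : r = ∑ k ∈ (r : A[X]).support,
        (⟨monomial k ((r : A[X]).coeff k), reesAlgebra.monomial_mem.2 (r.2 k)⟩ :
          reesAlgebra (I ^ n)) := by
      refine Subtype.ext ?_
      rw [AddSubmonoidClass.coe_finsetSum]
      exact (r : A[X]).as_sum_support
    rw [hsum]
    refine sum_mem fun k hk => ?_
    have hk0 : 0 < k := Nat.pos_of_ne_zero fun h => mem_support_iff.1 hk (h ▸ h0)
    exact (monomial_mem_radical x hx hn hk0 (r.2 k)).2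
  obtain ⟨K, hK⟩ := hr'
  refine ⟨K, ?_⟩
  have h1 := Ideal.mem_map_of_mem (Ideal.Quotient.mk (reesShiftIdeal (I ^ n))) hK
  rwa [Ideal.map_span, ← Set.range_comp, map_pow] at h1

end Irrelevant

/-! ### Cohomology in degrees zero and one by elements -/

section LowDegrees

variable {R : Type*} [CommRing R] {m : ℕ} {f : Fin m → R}
variable {E : Type*} [AddCommGroup E] [Module R E] {gr : ℤ → AddSubgroup E}

/-- The one-element index `{i}`. -/
def singleEmb (i : Fin m) : Fin 1 ↪o Fin m :=
  OrderEmbedding.ofStrictMono (fun _ => i) fun a b h => absurd h (by simp [Subsingleton.elim a b])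

theorem eq_singleEmb (σ : Fin 1 ↪o Fin m) : σ = singleEmb (σ 0) := by
  ext k
  rw [Subsingleton.elim k 0]
  rfl

theorem cechProd_one (σ : Fin 1 ↪o Fin m) : cechProd f σ = f (σ 0) := by
  rw [cechProd, Fin.prod_univ_one]

theorem cechProd_zero (σ : Fin 0 ↪o Fin m) : cechProd f σ = 1 := by
  rw [cechProd, Fin.prod_univ_zero]

theorem cechD_zero_apply (c : CechCochain f E 0) (σ : Fin 1 ↪o Fin m) (e : E) (k : ℕ)
    (hc : ∀ τ, c τ = powFrac _ e k) : cechD f E 0 c σ = powFrac _ e 0 := by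
  rw [cechD_apply, Fin.sum_univ_one, hc, Fin.val_zero, pow_zero, one_smul,
    localizationRes_powFrac _ (cechProd_eq_face_mul σ 0), powFrac_eq_iff]
  refine ⟨0, ?_⟩
  rw [cechProd_one]
  simp

theorem cechD_one_apply (c : CechCochain f E 1) (σ : Fin 2 ↪o Fin m) (e : Fin m → E) (k : ℕ)
    (hc : ∀ τ : Fin 1 ↪o Fin m, c τ = powFrac _ (e (τ 0)) k) :
    cechD f E 1 c σ =
      powFrac _ (f (σ 0) ^ k • e (σ 1) - f (σ 1) ^ k • e (σ 0)) k := by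
  rw [cechD_apply, Fin.sum_univ_two, hc, hc, localizationRes_powFrac _ (cechProd_eq_face_mul σ 0),
    localizationRes_powFrac _ (cechProd_eq_face_mul σ 1), powFrac_sub, Fin.val_zero, Fin.val_one,
    pow_zero, pow_one, one_smul, neg_smul, one_smul, sub_eq_add_neg]
  rfl

/-- If `H^0(E)_d = 0`, then `0` is the only element of degree `d` killed by powers of the `f_i`. -/
theorem eq_zero_of_cechCohomologyDeg_zero {d : ℤ} (hH : cechCohomologyDeg f gr 0 d = ⊥)
    (hd : ActsInDegreeOne f gr) {e : E} (he : e ∈ gr d) {s : ℕ} (hs : ∀ i, f i ^ s • e = 0) :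
    e = 0 := by
  rw [cechCohomologyDeg_eq_bot_iff] at hH
  let c : CechCochain f E 0 := fun σ => powFrac _ e 0
  have h1 : c = 0 := (Submodule.mem_bot R).1 (hH c (mem_cechDeg.2 fun σ =>
    (mem_localizationDeg_iff hd _ _ _).2 ⟨0, e, by simpa using he, rfl⟩) (by
      funext σ
      rw [cechD_zero_apply c σ e 0 fun τ => rfl, Pi.zero_apply, powFrac_eq_zero_iff]
      exact ⟨s, by rw [cechProd_one, hs]⟩))
  obtain ⟨t, ht⟩ := (powFrac_eq_zero_iff _ _ _).1 (congrFun h1 (OrderEmbedding.ofIsEmpty))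
  rwa [cechProd_zero, one_pow, one_smul] at ht

/-- If `H^1(E)_d = 0`, then compatible systems `e_i / f_i^K` of fractions of degree `d` come from
an element of `E`. -/
theorem exists_of_cechCohomologyDeg_one {d : ℤ} (hH : cechCohomologyDeg f gr 1 d = ⊥)
    (hd : ActsInDegreeOne f gr) {K : ℕ} {e : Fin m → E} (he : ∀ i, e i ∈ gr (d + K))
    (hs : ∀ i j, f j ^ K • e i = f i ^ K • e j) :
    ∃ (v : E) (s : ℕ), ∀ i, f i ^ s • (f i ^ K • v - e i) = 0 := by
  rw [cechCohomologyDeg_eq_bot_iff] at hH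
  let c : CechCochain f E 1 := fun σ => powFrac _ (e (σ 0)) K
  obtain ⟨b, hb⟩ := hH c (mem_cechDeg.2 fun σ =>
    (mem_localizationDeg_iff hd _ _ _).2 ⟨K, e (σ 0), by simpa using he (σ 0), rfl⟩) (by
      funext σ
      rw [cechD_one_apply c σ e K fun τ => rfl, hs, sub_self, powFrac_zero, Pi.zero_apply])
  obtain ⟨v, k, hv⟩ := exists_powFrac _ (b OrderEmbedding.ofIsEmpty)
  have hb' : ∀ τ, b τ = powFrac _ v k := fun τ => by
    have h0 : τ = OrderEmbedding.ofIsEmpty := by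
      ext l
      exact l.elim0
    rw [h0]
    exact hv
  have key : ∀ i, ∃ s, f i ^ s • (f i ^ K • v - e i) = 0 := fun i => by
    have h1 := congrFun hb (singleEmb i)
    rw [cechD_zero_apply b _ v k hb'] at h1
    obtain ⟨s, hs⟩ := (powFrac_eq_iff _ _ _ _ _).1 h1
    rw [cechProd_one, pow_zero, one_smul] at hs
    exact ⟨s, by rw [smul_sub, sub_eq_zero]; exact hs⟩
  obtain ⟨s, hs⟩ := exists_uniform_bound
    (P := fun i s => f i ^ s • (f i ^ K • v - e i) = 0) (fun i s t hst h => by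
      rw [← Nat.sub_add_cancel hst, pow_add, mul_smul, h, smul_zero]) key
  exact ⟨v, s, hs⟩

theorem cechCohomologyDeg_zero_eq_bot {d : ℤ} (hd : ActsInDegreeOne f gr)
    (h0 : ∀ e ∈ gr d, e = 0) : cechCohomologyDeg f gr 0 d = ⊥ := by
  rw [cechCohomologyDeg_eq_bot_iff]
  intro c hc _
  have : c = 0 := by
    funext σ
    obtain ⟨k, e, he, hk⟩ := (mem_localizationDeg_iff hd _ _ _).1 (mem_cechDeg.1 hc σ)
    rw [hk, h0 e (by simpa using he), powFrac_zero, Pi.zero_apply]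
  rw [this]
  exact zero_mem _

/-- If the members of every compatible system `e_i / f_i^K` of degree `d` are zero as fractions,
then `H^1(E)_d = 0`. A cocycle gives such a system once all its components and the relations between
them are written with sufficiently large powers. -/
theorem cechCohomologyDeg_one_eq_bot {d : ℤ} (hd : ActsInDegreeOne f gr)
    (h0 : ∀ (K : ℕ) (e : Fin m → E), (∀ i, e i ∈ gr (d + K)) →
      (∀ i j, f j ^ K • e i = f i ^ K • e j) → ∀ i, ∃ s, f i ^ s • e i = 0) :
    cechCohomologyDeg f gr 1 d = ⊥ := by
  rw [cechCohomologyDeg_eq_bot_iff]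
  intro c hc hdc
  have key : ∀ i, ∃ k : ℕ, ∃ e ∈ gr (d + k), c (singleEmb i) = powFrac _ e k := fun i => by
    obtain ⟨k, e, he, hk⟩ :=
      (mem_localizationDeg_iff hd _ _ _).1 (mem_cechDeg.1 hc (singleEmb i))
    exact ⟨k, e, by simpa using he, hk⟩
  obtain ⟨k, hk⟩ := exists_uniform_bound (fun i s t hst => by
    rintro ⟨e, he, hse⟩
    refine ⟨f i ^ (t - s) • e, ?_, ?_⟩
    · convert hd.pow_smul_mem i (t - s) he using 2
      push_cast [hst]
      ring
    · rw [hse, powFrac_raise _ e s (t - s), cechProd_one, Nat.add_sub_cancel' hst]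
      rfl) key
  choose e he hce using hk
  have hce' : ∀ τ : Fin 1 ↪o Fin m, c τ = powFrac _ (e (τ 0)) k := fun τ => by
    rw [eq_singleEmb τ]
    exact hce (τ 0)
  have hlt : ∀ i j, i < j →
      ∃ s, (f i * f j) ^ s • (f i ^ k • e j - f j ^ k • e i) = 0 := fun i j hij => by
    let σ : Fin 2 ↪o Fin m := OrderEmbedding.ofStrictMono ![i, j] (by
      intro a b hab
      fin_cases a <;> fin_cases b <;> simp_all)
    have h1 := congrFun hdc σ
    rw [cechD_one_apply c σ e k hce', Pi.zero_apply, powFrac_eq_zero_iff] at h1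
    obtain ⟨s, hs⟩ := h1
    rw [cechProd, Fin.prod_univ_two] at hs
    exact ⟨s, hs⟩
  have hpair : ∀ q : Fin m × Fin m,
      ∃ s, (f q.1 * f q.2) ^ s • (f q.1 ^ k • e q.2 - f q.2 ^ k • e q.1) = 0 := fun ⟨i, j⟩ => by
    rcases lt_trichotomy i j with h | rfl | h
    · exact hlt i j h
    · exact ⟨0, by simp⟩
    · obtain ⟨s, hs⟩ := hlt j i h
      refine ⟨s, ?_⟩
      simp only
      rw [mul_comm, ← neg_sub, smul_neg, hs, neg_zero]
  obtain ⟨s, hs⟩ := exists_uniform_bound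
    (P := fun (q : Fin m × Fin m) s =>
      (f q.1 * f q.2) ^ s • (f q.1 ^ k • e q.2 - f q.2 ^ k • e q.1) = 0) (fun q s t hst h => by
      rw [← Nat.sub_add_cancel hst, pow_add, mul_smul, h, smul_zero]) hpair
  have hzero := h0 (k + s) (fun i => f i ^ s • e i) (fun i => by
      convert hd.pow_smul_mem i s (he i) using 2
      push_cast
      ring) (fun i j => by
      have h1 := hs (j, i)
      simp only at h1
      rw [smul_sub, sub_eq_zero, smul_smul, smul_smul] at h1
      rw [smul_smul, smul_smul]
      convert h1 using 2 <;> ring)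
  have : c = 0 := by
    funext τ
    obtain ⟨t, ht⟩ := hzero (τ 0)
    rw [hce', Pi.zero_apply, powFrac_eq_zero_iff]
    exact ⟨t + s, by rw [cechProd_one, pow_add, mul_smul, ht]⟩
  rw [this]
  exact zero_mem _

end LowDegrees

/-! ### The cohomology of `L^I(M)` in degrees zero and one -/

section LCohomology

variable {A : Type u} [CommRing A] {I : Ideal A} {M : Type v} [AddCommGroup M] [Module A M]
variable {m : ℕ} (x : Fin m → I)

theorem actsInDegreeOne_lModuleDeg : ActsInDegreeOne (reesGen x) (lModuleDeg I M) :=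
  (gradedShortExact_mkQ (lSubmodule I M) (polyDeg A M)).actsInDegreeOne_right
    (isGradingWith_polyDeg M x).actsInDegreeOne

variable (I) in
/-- The class of `a` in the degree `k` part `M / I^{k+1}M` of `L^I(M)`. -/
def lClass (k : ℕ) (a : M) : LModule I M :=
  (lSubmodule I M).mkQ (PolynomialModule.single A k a)

theorem lClass_eq_zero_iff (k : ℕ) (a : M) :
    lClass I k a = 0 ↔ a ∈ I ^ (k + 1) • (⊤ : Submodule A M) := by
  rw [lClass, Submodule.mkQ_apply, Submodule.Quotient.mk_eq_zero]
  constructor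
  · intro h
    simpa using h k
  · intro h l
    rw [PolynomialModule.coeff_single]
    by_cases hl : k = l
    · subst hl
      rwa [Finsupp.single_eq_same]
    · rw [Finsupp.single_eq_of_ne' hl]
      exact zero_mem _

theorem lClass_sub (k : ℕ) (a b : M) : lClass I k a - lClass I k b = lClass I k (a - b) := by
  rw [lClass, lClass, lClass, ← map_sub]
  congr 1
  exact (map_sub (PolynomialModule.lsingle A k) a b).symm

theorem reesGen_pow_smul_single (i : Fin m) (s k : ℕ) (a : M) :
    reesGen x i ^ s • PolynomialModule.single A k a =
      PolynomialModule.single A (s + k) ((x i : A) ^ s • a) := by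
  rw [Subalgebra.smul_def, coe_reesGen_pow, PolynomialModule.monomial_smul_single]

theorem reesGen_pow_smul_lClass (i : Fin m) (s k : ℕ) (a : M) :
    reesGen x i ^ s • lClass I k a = lClass I (s + k) ((x i : A) ^ s • a) := by
  rw [lClass, lClass, ← map_smul, reesGen_pow_smul_single]

theorem lClass_mem {d : ℤ} {k : ℕ} (h : (k : ℤ) = d) (a : M) : lClass I k a ∈ lModuleDeg I M d :=
  ⟨_, fun l hl => by
    rw [PolynomialModule.coeff_single, Finsupp.single_eq_of_ne' (by lia)], rfl⟩

theorem exists_lClass {d : ℤ} {k : ℕ} (h : (k : ℤ) = d) {e : LModule I M}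
    (he : e ∈ lModuleDeg I M d) : ∃ a, e = lClass I k a := by
  obtain ⟨ε, hε, rfl⟩ := he
  exact ⟨ε.coeff k, by
    rw [lClass, single_coeff_of_mem_polyDeg hε h]
    rfl⟩

theorem eq_zero_of_mem_lModuleDeg {d : ℤ} (hd : d < 0) {e : LModule I M}
    (he : e ∈ lModuleDeg I M d) : e = 0 := by
  obtain ⟨ε, hε, rfl⟩ := he
  have : ε = 0 := by
    ext k
    exact hε k (by lia)
  rw [this]
  exact map_zero _

variable (M) in
/-- `H^0(L^I(M))` is a submodule of `L^I(M)`, which has no elements of negative degree. -/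
theorem lCohomologyDeg_zero_eq_bot {d : ℤ} (hd : d < 0) : lCohomologyDeg M x 0 d = ⊥ :=
  cechCohomologyDeg_zero_eq_bot (f := reesGen x) (gr := lModuleDeg I M)
    (actsInDegreeOne_lModuleDeg x) fun _ he => eq_zero_of_mem_lModuleDeg hd he

/-- The vanishing of `H^0(L^I(M))_d` in terms of elements; here `D = d + 1`, so that the degree `d`
part of `L^I(M)` is `M / I^D M`. -/
theorem mem_of_lCohomologyDeg_zero {d : ℤ} (hH : lCohomologyDeg M x 0 d = ⊥) {D s : ℕ}
    (hD : (D : ℤ) = d + 1) {a : M}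
    (ha : ∀ i, (x i : A) ^ s • a ∈ I ^ (D + s) • (⊤ : Submodule A M)) :
    a ∈ I ^ D • (⊤ : Submodule A M) := by
  rcases D with _ | k
  · simp
  rw [← lClass_eq_zero_iff]
  refine eq_zero_of_cechCohomologyDeg_zero (f := reesGen x) (gr := lModuleDeg I M) hH
    (actsInDegreeOne_lModuleDeg x) (lClass_mem (by push_cast at hD; linarith) a) (s := s)
    fun i => ?_
  rw [reesGen_pow_smul_lClass, lClass_eq_zero_iff]
  convert ha i using 3
  ring

/-- The vanishing of `H^1(L^I(M))_d` in terms of elements: compatible systems of fractions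
`u_i / (x_i t)^K`, with numerators in degree `d + K = D - 1`, come from an element of degree `d`,
which is zero if `d < 0`. -/
theorem exists_of_lCohomologyDeg_one {d : ℤ} (hH : lCohomologyDeg M x 1 d = ⊥) {D K : ℕ}
    (hD : (D : ℤ) = d + 1 + K) {u : Fin m → M}
    (hu : ∀ i j, (x j : A) ^ K • u i - (x i : A) ^ K • u j ∈ I ^ (D + K) • (⊤ : Submodule A M)) :
    ∃ (v : M) (s : ℕ), (d < 0 → v = 0) ∧
      ∀ i, (x i : A) ^ s • ((x i : A) ^ K • v - u i) ∈ I ^ (D + s) • (⊤ : Submodule A M) := by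
  rcases D with _ | k
  · refine ⟨0, 0, fun _ => rfl, by simp⟩
  have hdk : d = k - K := by
    push_cast at hD
    linarith
  clear hD
  obtain ⟨e, s, he⟩ := exists_of_cechCohomologyDeg_one (f := reesGen x) (gr := lModuleDeg I M) hH
    (actsInDegreeOne_lModuleDeg x) (K := K) (e := fun i => lClass I k (u i))
    (fun i => lClass_mem (by rw [hdk]; ring) _) (fun i j => by
      rw [← sub_eq_zero, reesGen_pow_smul_lClass, reesGen_pow_smul_lClass, lClass_sub,
        lClass_eq_zero_iff]
      convert hu i j using 3
      ring)
  clear hH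
  obtain ⟨ε, rfl⟩ := Submodule.mkQ_surjective _ e
  refine ⟨if K ≤ k then ε.coeff (k - K) else 0, s, fun hd => if_neg (by omega), fun i => ?_⟩
  have h1 := he i
  rw [lClass, ← map_smul, ← map_sub, ← map_smul, Submodule.mkQ_apply,
    Submodule.Quotient.mk_eq_zero] at h1
  have h2 := h1 (s + k)
  rw [coeff_reesGen_pow_smul, if_pos (Nat.le_add_right s k), Nat.add_sub_cancel_left] at h2
  have h3 : (reesGen x i ^ K • ε - PolynomialModule.single A k (u i)).coeff k =
      (x i : A) ^ K • (if K ≤ k then ε.coeff (k - K) else 0) - u i := by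
    change (reesGen x i ^ K • ε).coeff k - (PolynomialModule.single A k (u i)).coeff k = _
    rw [coeff_reesGen_pow_smul, PolynomialModule.coeff_single, Finsupp.single_eq_same]
    split_ifs <;> simp
  rw [h3] at h2
  convert h2 using 3
  ring

/-- A criterion for `H^1(L^I(M))_d = 0` in terms of elements. -/
theorem lCohomologyDeg_one_eq_bot {d : ℤ}
    (h : ∀ (k K : ℕ) (u : Fin m → M), (k : ℤ) = d + K →
      (∀ i j, (x j : A) ^ K • u i - (x i : A) ^ K • u j ∈ I ^ (k + 1 + K) • (⊤ : Submodule A M)) →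
      ∀ i, ∃ s, (x i : A) ^ s • u i ∈ I ^ (k + 1 + s) • (⊤ : Submodule A M)) :
    lCohomologyDeg M x 1 d = ⊥ := by
  refine cechCohomologyDeg_one_eq_bot (f := reesGen x) (gr := lModuleDeg I M)
    (actsInDegreeOne_lModuleDeg x) fun K e he hs i => ?_
  by_cases hneg : d + K < 0
  · exact ⟨0, by rw [eq_zero_of_mem_lModuleDeg hneg (he i), smul_zero]⟩
  obtain ⟨k, hk⟩ := Int.eq_ofNat_of_zero_le (not_lt.1 hneg)
  choose u hu using fun i => exists_lClass hk.symm (he i)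
  obtain ⟨s, hs⟩ := h k K u hk.symm (fun i j => by
    have h1 := hs i j
    rw [hu, hu, ← sub_eq_zero, reesGen_pow_smul_lClass, reesGen_pow_smul_lClass, lClass_sub,
        lClass_eq_zero_iff] at h1
    convert h1 using 3
    ring) i
  refine ⟨s, ?_⟩
  rw [hu, reesGen_pow_smul_lClass, lClass_eq_zero_iff]
  convert hs using 3
  ring

end LCohomology

/-! ### The grade of the associated graded module by elements -/

section AssocGraded

variable {A : Type u} [CommRing A] {J : Ideal A} {M : Type v} [AddCommGroup M] [Module A M]

/-- A shortcut for instance search. -/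
instance : SMul (assocGradedRing J) (assocGradedModule J M) :=
  (assocGradedModule_isTorsionBySet J M).module.toDistribMulAction.toDistribSMul.toSMul

/-- A shortcut for instance search. -/
instance : SMul (reesAlgebra J) (reesModule J M) :=
  (Submodule.module (reesModule J M)).toDistribMulAction.toDistribSMul.toSMul

/-- The class in `G_J(M)` of an element of the Rees module. -/
def gClass (e : reesModule J M) : assocGradedModule J M :=
  ⟨(lSubmodule J M).mkQ e, e, e.2, rfl⟩

theorem gClass_surjective (z : assocGradedModule J M) : ∃ e, z = gClass e := by
  obtain ⟨_, e, he, rfl⟩ := z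
  exact ⟨⟨e, he⟩, rfl⟩

theorem gClass_eq_zero_iff (e : reesModule J M) :
    gClass e = 0 ↔ ∀ k, (e : PolynomialModule A M).coeff k ∈ J ^ (k + 1) • (⊤ : Submodule A M) := by
  rw [← Subtype.coe_inj]
  exact Submodule.Quotient.mk_eq_zero (lSubmodule J M)

theorem gClass_sub (e e' : reesModule J M) : gClass e - gClass e' = gClass (e - e') := by
  refine Subtype.ext ?_
  exact (map_sub (lSubmodule J M).mkQ (e : PolynomialModule A M) e').symm

theorem mk_smul_gClass (r : reesAlgebra J) (e : reesModule J M) :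
    (Ideal.Quotient.mk (reesShiftIdeal J) r : assocGradedRing J) • gClass e = gClass (r • e) :=
  Subtype.ext (map_smul (lSubmodule J M).mkQ r (e : PolynomialModule A M)).symm

/-- A homogeneous element of the Rees module. -/
def reesSingle (k : ℕ) (a : M) (ha : a ∈ J ^ k • (⊤ : Submodule A M)) : reesModule J M :=
  ⟨PolynomialModule.single A k a, fun l => by
    rw [PolynomialModule.coeff_single]
    by_cases hl : k = l
    · subst hl
      rwa [Finsupp.single_eq_same]
    · rw [Finsupp.single_eq_of_ne' hl]
      exact zero_mem _⟩

variable {m : ℕ} (y : Fin m → J)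

theorem assocGen_pow_smul_gClass (i : Fin m) (s : ℕ) (e : reesModule J M) :
    assocGen y i ^ s • gClass e = gClass (reesGen y i ^ s • e) := by
  rw [assocGen, ← map_pow, mk_smul_gClass]

theorem assocGen_smul_gClass (i : Fin m) (e : reesModule J M) :
    assocGen y i • gClass e = gClass (reesGen y i • e) := mk_smul_gClass _ _

theorem coeff_coe_sub (e e' : reesModule J M) (k : ℕ) :
    ((e - e' : reesModule J M) : PolynomialModule A M).coeff k =
      (e : PolynomialModule A M).coeff k - (e' : PolynomialModule A M).coeff k := rfl

theorem coeff_coe_pow_smul (i : Fin m) (s : ℕ) (e : reesModule J M) (k : ℕ) :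
    ((reesGen y i ^ s • e : reesModule J M) : PolynomialModule A M).coeff k =
      if s ≤ k then (y i : A) ^ s • (e : PolynomialModule A M).coeff (k - s) else 0 :=
  coeff_reesGen_pow_smul y i s (e : PolynomialModule A M) k

theorem assocGradedModule_finite [IsNoetherianRing A] [Module.Finite A M] :
    Module.Finite (assocGradedRing J) (assocGradedModule J M) := by
  have hfg : (reesModule J M).FG :=
    ((J.stableFiltration (⊤ : Submodule A M)).submodule_fg_iff_stable
      fun i => IsNoetherian.noetherian _).2 (J.stableFiltration_stable _)
  have hfin : Module.Finite (reesAlgebra J) (assocGradedModule J M) :=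
    Module.Finite.iff_fg.2 (hfg.map _)
  obtain ⟨S, hS⟩ := hfin.fg_top
  refine ⟨S, ?_⟩
  rw [eq_top_iff]
  intro z _
  have hz : z ∈ Submodule.span (reesAlgebra J) (S : Set (assocGradedModule J M)) :=
    hS ▸ Submodule.mem_top
  induction hz using Submodule.span_induction with
  | mem z hz => exact Submodule.subset_span hz
  | zero => exact zero_mem _
  | add a b _ _ ha hb => exact add_mem (ha trivial) (hb trivial)
  | smul r a _ ha =>
    exact Submodule.smul_mem _ (Ideal.Quotient.mk (reesShiftIdeal J) r : assocGradedRing J)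
      (ha trivial)

/-- If `H^0(L^J(M)) = 0`, then `H^0(G_J(M)) = 0`. -/
theorem gClass_eq_zero_of_forall
    (h0 : ∀ (D s : ℕ) (a : M), (∀ i, (y i : A) ^ s • a ∈ J ^ (D + s) • (⊤ : Submodule A M)) →
      a ∈ J ^ D • (⊤ : Submodule A M)) (z : assocGradedModule J M) (s : ℕ)
    (hz : ∀ i, assocGen y i ^ s • z = 0) : z = 0 := by
  obtain ⟨e, rfl⟩ := gClass_surjective z
  rw [gClass_eq_zero_iff]
  intro k
  refine h0 (k + 1) s _ fun i => ?_
  have h1 := hz i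
  rw [assocGen_pow_smul_gClass, gClass_eq_zero_iff] at h1
  have h2 := h1 (k + s)
  rw [coeff_coe_pow_smul, if_pos (Nat.le_add_left s k), Nat.add_sub_cancel] at h2
  rwa [add_right_comm]

/-- Elements of the Rees module with prescribed homogeneous components up to a bound. -/
theorem exists_reesModule_coeff (B : ℕ) (v : ℕ → M)
    (hv : ∀ k, v k ∈ J ^ k • (⊤ : Submodule A M)) :
    ∃ e : reesModule J M, ∀ k,
      (e : PolynomialModule A M).coeff k = if k < B then v k else 0 := by
  classical
  let g : ℕ →₀ M := Finsupp.onFinset (Finset.range B) (fun k => if k < B then v k else 0)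
    fun k hk => Finset.mem_range.2 (by
      by_contra h
      exact hk (if_neg h))
  refine ⟨⟨.ofCoeff A g, fun k => ?_⟩, fun k => rfl⟩
  change (if k < B then v k else 0) ∈ J ^ k • (⊤ : Submodule A M)
  split_ifs
  · exact hv k
  · exact zero_mem _

/-- If `H^0` and `H^1` of `L^J(M)` vanish, then so does `H^1(G_J(M))`. Compatible systems in
`G_J(M)` are solved in each degree by some `v k ∈ M`; by the vanishing of `H^0` these lie in the
Rees module. -/
theorem exists_gClass_of_forall
    (h0 : ∀ (D s : ℕ) (a : M), (∀ i, (y i : A) ^ s • a ∈ J ^ (D + s) • (⊤ : Submodule A M)) →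
      a ∈ J ^ D • (⊤ : Submodule A M))
    (h1 : ∀ (k : ℕ) (u : Fin m → M),
      (∀ i j, (y j : A) • u i - (y i : A) • u j ∈ J ^ (k + 2) • (⊤ : Submodule A M)) →
      ∃ (v : M) (s : ℕ), (k = 0 → v = 0) ∧
        ∀ i, (y i : A) ^ s • ((y i : A) • v - u i) ∈ J ^ (k + 1 + s) • (⊤ : Submodule A M))
    (e : Fin m → assocGradedModule J M) (he : ∀ i j, assocGen y j • e i = assocGen y i • e j) :
    ∃ (v : assocGradedModule J M) (s : ℕ), ∀ i,
      assocGen y i ^ s • (assocGen y i • v - e i) = 0 := by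
  choose ε hε using fun i => gClass_surjective (e i)
  let c : Fin m → ℕ → M := fun i k => (ε i : PolynomialModule A M).coeff k
  have hc : ∀ i k, c i k ∈ J ^ k • (⊤ : Submodule A M) := fun i => (ε i).2
  have hrel : ∀ k i j, (y j : A) • c i k - (y i : A) • c j k ∈
      J ^ (k + 2) • (⊤ : Submodule A M) := fun k i j => by
    have h2 := he i j
    rw [hε, hε, ← sub_eq_zero, assocGen_smul_gClass, assocGen_smul_gClass, gClass_sub,
      gClass_eq_zero_iff] at h2
    have h3 := h2 (k + 1)
    rw [coeff_coe_sub, ← pow_one (reesGen y i), ← pow_one (reesGen y j), coeff_coe_pow_smul,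
      coeff_coe_pow_smul, if_pos (Nat.le_add_left 1 k), if_pos (Nat.le_add_left 1 k),
      Nat.add_sub_cancel, pow_one, pow_one] at h3
    exact h3
  -- The component of degree `k` of the system is solved by `v k`, to be placed in degree `k - 1`.
  choose v s hv0 hvs using fun k => h1 k (fun i => c i k) (hrel k)
  have hvmem : ∀ k, v (k + 1) ∈ J ^ k • (⊤ : Submodule A M) := fun k => by
    refine h0 k (s (k + 1) + 1) _ fun i => ?_
    have h2 : (y i : A) ^ s (k + 1) • ((y i : A) • v (k + 1) - c i (k + 1)) ∈
        J ^ (k + (s (k + 1) + 1)) • (⊤ : Submodule A M) :=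
      Submodule.smul_mono_left (Ideal.pow_le_pow_right (by omega)) (hvs (k + 1) i)
    have h3 : (y i : A) ^ s (k + 1) • c i (k + 1) ∈
        J ^ (k + (s (k + 1) + 1)) • (⊤ : Submodule A M) := by
      have h4 := Submodule.smul_mem_smul (Ideal.pow_mem_pow (y i).2 (s (k + 1))) (hc i (k + 1))
      rw [← Submodule.mul_smul, ← pow_add] at h4
      convert h4 using 3
      omega
    have h5 := add_mem h2 h3
    rwa [smul_sub, sub_add_cancel, smul_smul, ← pow_succ] at h5
  obtain ⟨B, hB⟩ : ∃ B, ∀ i k, B ≤ k → c i k = 0 := by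
    obtain ⟨B, hB⟩ := exists_uniform_bound (P := fun i B => ∀ k, B ≤ k → c i k = 0)
      (fun i s t hst h k hk => h k (hst.trans hk)) fun i => by
        obtain ⟨b, hb⟩ := (ε i : PolynomialModule A M).coeff.support.bddAbove
        refine ⟨b + 1, fun k hk => by_contra fun h => ?_⟩
        have := hb (Finsupp.mem_support_iff.2 h)
        omega
    exact ⟨B, hB⟩
  obtain ⟨w, hw⟩ := exists_reesModule_coeff B (fun k => v (k + 1)) hvmem
  let S := ∑ k ∈ Finset.range (B + 1), s k
  refine ⟨gClass w, S, fun i => ?_⟩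
  rw [hε, assocGen_smul_gClass, gClass_sub, assocGen_pow_smul_gClass, gClass_eq_zero_iff]
  intro l
  rw [coeff_coe_pow_smul]
  split_ifs with hl
  swap
  · exact zero_mem _
  obtain ⟨k, rfl⟩ := Nat.exists_eq_add_of_le hl
  rw [Nat.add_sub_cancel_left, coeff_coe_sub, ← pow_one (reesGen y i), coeff_coe_pow_smul]
  change (y i : A) ^ S • ((if 1 ≤ k then (y i : A) ^ 1 • (w : PolynomialModule A M).coeff (k - 1)
    else 0) - c i k) ∈ _
  rw [hw, pow_one]
  by_cases hkB : k ≤ B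
  · have h2 : (if 1 ≤ k then (y i : A) • (if k - 1 < B then v (k - 1 + 1) else 0) else 0) =
        (y i : A) • v k := by
      rcases k with _ | k
      · rw [hv0 0 rfl]
        simp
      · rw [if_pos (Nat.le_add_left 1 k), Nat.add_sub_cancel, if_pos (by omega)]
    have hsS : s k ≤ S :=
      Finset.single_le_sum (f := s) (fun _ _ => Nat.zero_le _) (Finset.mem_range.2 (by omega))
    rw [h2, ← Nat.sub_add_cancel hsS, pow_add (y i : A), mul_smul]
    have h3 := Submodule.smul_mem_smul (Ideal.pow_mem_pow (y i).2 (S - s k)) (hvs k i)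
    rw [← Submodule.mul_smul, ← pow_add] at h3
    convert h3 using 3
    omega
  · rw [hB i k (by omega), if_neg (c := k - 1 < B) (by omega)]
    simp

theorem one_le_gradeAssocGraded [IsNoetherianRing A] [Module.Finite A M]
    (h0 : ∀ (D s : ℕ) (a : M), (∀ i, (y i : A) ^ s • a ∈ J ^ (D + s) • (⊤ : Submodule A M)) →
      a ∈ J ^ D • (⊤ : Submodule A M)) : 1 ≤ gradeAssocGraded J M := by
  have := assocGradedModule_finite (J := J) (M := M)
  obtain ⟨a, ha, hreg⟩ := exists_isSMulRegular_of_forall (R := assocGradedRing J)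
    (E := assocGradedModule J M) (𝔞 := irrelevantIdeal J) (f := assocGen y)
    (assocGen_mem_irrelevantIdeal y)
    fun z hz => gClass_eq_zero_of_forall y h0 z 1 fun i => by rw [pow_one]; exact hz i
  exact one_le_moduleGrade ha hreg

theorem two_le_gradeAssocGraded [IsNoetherianRing A] [Module.Finite A M]
    (h0 : ∀ (D s : ℕ) (a : M), (∀ i, (y i : A) ^ s • a ∈ J ^ (D + s) • (⊤ : Submodule A M)) →
      a ∈ J ^ D • (⊤ : Submodule A M))
    (h1 : ∀ (k : ℕ) (u : Fin m → M),
      (∀ i j, (y j : A) • u i - (y i : A) • u j ∈ J ^ (k + 2) • (⊤ : Submodule A M)) →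
      ∃ (v : M) (s : ℕ), (k = 0 → v = 0) ∧
        ∀ i, (y i : A) ^ s • ((y i : A) • v - u i) ∈ J ^ (k + 1 + s) • (⊤ : Submodule A M)) :
    2 ≤ gradeAssocGraded J M := by
  have := assocGradedModule_finite (J := J) (M := M)
  have h2 := gClass_eq_zero_of_forall y h0
  have h3 := exists_gClass_of_forall y h0 h1
  have h4 := two_le_moduleGrade_of_forall (R := assocGradedRing J)
    (E := assocGradedModule J M) (𝔞 := irrelevantIdeal J) (f := assocGen y)
    (assocGen_mem_irrelevantIdeal y)
  have h5 := h4 h2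
  exact h5 h3

/-- Successive approximation: if the grade of `G_J(M)` is at least `2`, then systems in `M` that are
compatible modulo `J^{r+N}` are solvable modulo `J^r`. The error of a solution modulo `J^r` defines
a compatible system in degree `r` of `G_J(M)`, whose solution corrects it. -/
theorem exists_of_two_le_gradeAssocGraded (h : 2 ≤ gradeAssocGraded J M)
    (hy : irrelevantIdeal J ≤
      Ideal.radical (R := assocGradedRing J) (Ideal.span (Set.range (assocGen y))))
    (N : ℕ) (r : ℕ) (u : Fin m → M)
    (hu : ∀ i j, (y j : A) ^ N • u i - (y i : A) ^ N • u j ∈ J ^ (r + N) • (⊤ : Submodule A M)) :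
    ∃ v : M, ∀ i, u i - (y i : A) ^ N • v ∈ J ^ r • (⊤ : Submodule A M) := by
  induction r with
  | zero => exact ⟨0, by simp⟩
  | succ r ih =>
    obtain ⟨v, hv⟩ := ih fun i j =>
      Submodule.smul_mono_left (Ideal.pow_le_pow_right (by omega)) (hu i j)
    let e : Fin m → reesModule J M := fun i => reesSingle r (u i - (y i : A) ^ N • v) (hv i)
    have hrad := hy.trans (radical_span_le_radical_span_pow (assocGen y) N)
    have hsolve := exists_smul_eq_of_two_le_moduleGrade (R := assocGradedRing J)
      (E := assocGradedModule J M) (f := fun i => assocGen y i ^ N) (𝔞 := irrelevantIdeal J)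
      (e := fun i => gClass (e i))
    have hsolve' := hsolve h
    have hsolve'' := hsolve' hrad
    obtain ⟨z, hz⟩ := hsolve'' fun i j => by
        rw [← sub_eq_zero, assocGen_pow_smul_gClass, assocGen_pow_smul_gClass, gClass_sub,
          gClass_eq_zero_iff]
        intro k
        rw [coeff_coe_sub, coeff_coe_pow_smul, coeff_coe_pow_smul]
        by_cases hk : k = r + N
        · subst hk
          rw [if_pos (Nat.le_add_left N r), if_pos (Nat.le_add_left N r), Nat.add_sub_cancel]
          change (y j : A) ^ N • (Finsupp.single r (u i - (y i : A) ^ N • v)) r -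
            (y i : A) ^ N • (Finsupp.single r (u j - (y j : A) ^ N • v)) r ∈ _
          rw [Finsupp.single_eq_same, Finsupp.single_eq_same]
          convert hu i j using 1
          swap
          · rw [smul_sub, smul_sub, smul_comm ((y j : A) ^ N) ((y i : A) ^ N) v]
            abel
          · congr 2
            omega
        · have hzero : ∀ l l', (if N ≤ k then (y l : A) ^ N •
              (e l' : PolynomialModule A M).coeff (k - N) else 0) = 0 := fun l l' => by
            split_ifs with hN
            · change (y l : A) ^ N • (Finsupp.single r _) (k - N) = 0
              rw [Finsupp.single_eq_of_ne' (by omega), smul_zero]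
            · rfl
          rw [hzero, hzero, sub_zero]
          exact zero_mem _
    obtain ⟨ε, rfl⟩ := gClass_surjective z
    refine ⟨v + if N ≤ r then (ε : PolynomialModule A M).coeff (r - N) else 0, fun i => ?_⟩
    have h1 := hz i
    rw [assocGen_pow_smul_gClass, ← sub_eq_zero, gClass_sub, gClass_eq_zero_iff] at h1
    have h2 := h1 r
    rw [coeff_coe_sub, coeff_coe_pow_smul] at h2
    have h3 : (e i : PolynomialModule A M).coeff r = u i - (y i : A) ^ N • v :=
      Finsupp.single_eq_same
    rw [h3] at h2
    convert neg_mem h2 using 1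
    split_ifs
    · rw [smul_add]
      abel
    · rw [add_zero]
      abel

end AssocGraded

/-! ### Comparison of `I` with its powers -/

section Comparison

variable {A : Type u} [CommRing A] {I : Ideal A} {M : Type v} [AddCommGroup M] [Module A M]
variable {m : ℕ} (x : Fin m → I)

/-- Beyond the amplitude, the cohomology of `L^I(M)` vanishes in the degrees `nk - 1`, which are the
degrees that make up `L^{I^n}(M)`. -/
theorem lCohomologyDeg_mul_sub_one_eq_bot {n : ℕ} (hn : amplitude M x < (n : ℕ∞)) {i : ℕ}
    (hi : (i : ℕ∞) < xiInvariant M x) (k : ℕ) : lCohomologyDeg M x i (n * k - 1) = ⊥ := by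
  rcases Nat.eq_zero_or_pos k with rfl | hk
  · have h1 : ¬(lCohomologyDeg M x i (-1) ≠ ⊥ ∨
        {j : ℤ | j < 0 ∧ lCohomologyDeg M x i j ≠ ⊥}.Infinite) := fun h =>
      lt_irrefl (i : ℕ∞) (hi.trans_le ((min_le_right _ _).trans
        (iInf₂_le i ⟨hi.trans_le (min_le_left _ _), h⟩)))
    have h2 : (n : ℤ) * (0 : ℕ) - 1 = -1 := by simp
    rw [h2]
    exact not_not.1 fun h => h1 (Or.inl h)
  · by_contra h
    have h1 : ((((n : ℤ) * k).natAbs : ℕ) : ℕ∞) ≤ amplitude M x :=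
      le_iSup₂_of_le (n * k : ℤ) ⟨i, hi, h⟩ le_rfl
    have h2 : (n : ℕ∞) ≤ ((((n : ℤ) * k).natAbs : ℕ) : ℕ∞) := by
      rw [Int.natAbs_mul, Int.natAbs_natCast, Int.natAbs_natCast]
      exact_mod_cast Nat.le_mul_of_pos_right n hk
    exact lt_irrefl _ (hn.trans_le (h2.trans h1))

/-- `ξ_I(M) ≥ 1`, as `H^0(L^I(M))` vanishes in negative degrees. -/
theorem zero_lt_xiInvariant (hgrade : 0 < moduleGrade I M) : 0 < xiInvariant M x := by
  refine lt_of_lt_of_le zero_lt_one (le_min (Order.one_le_iff_pos.2 hgrade)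
    (le_iInf₂ fun i hi => ?_))
  rcases i with _ | i
  · exfalso
    rcases hi.2 with h | h
    · exact h (lCohomologyDeg_zero_eq_bot M x (by norm_num))
    · obtain ⟨j, hj, hj'⟩ := h.nonempty
      exact hj' (lCohomologyDeg_zero_eq_bot M x hj)
  · exact_mod_cast Nat.le_add_left 1 i

/-- `H^0(L^{I^n}(M)) = 0` beyond the amplitude. -/
theorem mem_pow_of_amplitude_lt (hgrade : 0 < moduleGrade I M) {n : ℕ}
    (hn : amplitude M x < (n : ℕ∞)) (D s : ℕ) (a : M)
    (ha : ∀ i, (powGen x n i : A) ^ s • a ∈ (I ^ n) ^ (D + s) • (⊤ : Submodule A M)) :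
    a ∈ (I ^ n) ^ D • (⊤ : Submodule A M) := by
  rw [← pow_mul]
  refine mem_of_lCohomologyDeg_zero x
    (lCohomologyDeg_mul_sub_one_eq_bot (i := 0) x hn (zero_lt_xiInvariant x hgrade) D) (s := n * s)
    (by push_cast; ring) fun i => ?_
  have h1 := ha i
  rw [← pow_mul] at h1
  change ((x i : A) ^ n) ^ s • a ∈ _ at h1
  rwa [← pow_mul, mul_add] at h1

/-- The vanishing of `H^1(L^{I^n}(M))` beyond the amplitude, when `ξ_I(M) ≥ 2`. -/
theorem exists_of_amplitude_lt (hxi : 1 < xiInvariant M x) {n : ℕ}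
    (hn : amplitude M x < (n : ℕ∞)) (k : ℕ) (u : Fin m → M)
    (hu : ∀ i j, (powGen x n j : A) • u i - (powGen x n i : A) • u j ∈
      (I ^ n) ^ (k + 2) • (⊤ : Submodule A M)) :
    ∃ (v : M) (s : ℕ), (k = 0 → v = 0) ∧ ∀ i, (powGen x n i : A) ^ s •
      ((powGen x n i : A) • v - u i) ∈ (I ^ n) ^ (k + 1 + s) • (⊤ : Submodule A M) := by
  have hn0 : 0 < n := by
    have := lt_of_le_of_lt (zero_le (a := amplitude M x)) hn
    exact_mod_cast this
  obtain ⟨v, s, hv0, hv⟩ := exists_of_lCohomologyDeg_one x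
    (lCohomologyDeg_mul_sub_one_eq_bot (i := 1) x hn (by exact_mod_cast hxi) k)
    (D := n * (k + 1)) (K := n) (by push_cast; ring) (u := u) fun i j => by
      have h1 := hu i j
      rw [← pow_mul, show n * (k + 2) = n * (k + 1) + n by ring] at h1
      exact h1
  refine ⟨v, s, fun hk => hv0 (by rw [hk]; simp), fun i => ?_⟩
  have h1 := Submodule.smul_mem_smul (Ideal.pow_mem_pow (x i).2 (n * s - s)) (hv i)
  have hs : s ≤ n * s := Nat.le_mul_of_pos_left s hn0
  rw [smul_smul ((x i : A) ^ (n * s - s)) ((x i : A) ^ s), ← pow_add, Nat.sub_add_cancel hs,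
    ← Submodule.mul_smul, ← pow_add] at h1
  change ((x i : A) ^ n) ^ s • ((x i : A) ^ n • v - u i) ∈ _
  rw [← pow_mul, ← pow_mul]
  convert h1 using 3
  have : n * (k + 1 + s) = n * (k + 1) + n * s := by ring
  omega

/-- If `grade(G_{I^n}(A)₊, G_{I^n}(M)) ≥ 2` for some `n ≥ 1`, then `H^1(L^I(M))_d = 0` for all
`d < 0`. A class of degree `d < 0` is given by its local components; multiplying by `(x_l t)^q`,
which is invertible on the `l`-th component, moves it to degree `-1`. -/
theorem lCohomologyDeg_one_eq_bot_of_two_le (hx : Ideal.span (Set.range fun i => (x i : A)) = I)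
    {n : ℕ} (hn : 0 < n) (h : 2 ≤ gradeAssocGraded (I ^ n) M) {d : ℤ} (hd : d < 0) :
    lCohomologyDeg M x 1 d = ⊥ := by
  refine lCohomologyDeg_one_eq_bot x fun k K u hk hu l => ?_
  -- `q = -1 - d`, as `k = d + K`.
  obtain ⟨q, hq⟩ : ∃ q : ℕ, k + 1 + q = K := ⟨K - (k + 1), by omega⟩
  have hKn : K ≤ n * K := Nat.le_mul_of_pos_left K hn
  obtain ⟨t, ht⟩ := Nat.exists_eq_add_of_le hKn
  have hadd : ∀ (i : Fin m) (a b : ℕ) (w : M), w ∈ I ^ b • (⊤ : Submodule A M) →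
      (x i : A) ^ a • w ∈ I ^ (a + b) • (⊤ : Submodule A M) := fun i a b w hw => by
    have := Submodule.smul_mem_smul (Ideal.pow_mem_pow (x i).2 a) hw
    rwa [← Submodule.mul_smul, ← pow_add] at this
  obtain ⟨v, hv⟩ := exists_of_two_le_gradeAssocGraded (powGen x n) h
    (irrelevantIdeal_le_radical x hx hn) K K
    (fun i => (x l : A) ^ q • (x i : A) ^ t • u i) fun i j => by
      have h1 := hadd l q _ _ (hadd i t _ _ (hadd j t _ _ (hu i j)))
      convert h1 using 1
      swap
      · change ((x j : A) ^ n) ^ K • (x l : A) ^ q • (x i : A) ^ t • u i -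
          ((x i : A) ^ n) ^ K • (x l : A) ^ q • (x j : A) ^ t • u j = _
        rw [← pow_mul, ← pow_mul, ht, smul_sub, smul_sub, smul_sub]
        simp only [smul_smul]
        congr 2 <;> ring
      · rw [← pow_mul]
        congr 2
        have : n * (K + K) = n * K + n * K := by ring
        omega
  have h2 := hv l
  have h3 : (powGen x n l : A) ^ K • v ∈ (I ^ n) ^ K • (⊤ : Submodule A M) :=
    Submodule.smul_mem_smul (Ideal.pow_mem_pow (powGen x n l).2 K) Submodule.mem_top
  have h4 := add_mem h2 h3
  rw [sub_add_cancel, smul_smul, ← pow_add, ← pow_mul] at h4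
  refine ⟨q + t, ?_⟩
  convert h4 using 3
  omega

/-- If `grade(G_{I^n}(A)₊, G_{I^n}(M)) ≥ 2` for some `n ≥ 1`, then `grade(I, M) ≥ 2`: compatible
systems in `M` are solvable modulo all powers of `I^n`. -/
theorem two_le_moduleGrade_of_two_le [IsNoetherianRing A] [IsLocalRing A] [Module.Finite A M]
    (hx : Ideal.span (Set.range fun i => (x i : A)) = I) (hgrade : 0 < moduleGrade I M)
    {n : ℕ} (hn : 0 < n) (h : 2 ≤ gradeAssocGraded (I ^ n) M) : 2 ≤ moduleGrade I M := by
  by_cases hI : I = ⊤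
  · rw [hI]
    exact two_le_moduleGrade_top
  have hJ : I ^ n ≠ ⊤ := fun h => hI (by
    rw [eq_top_iff, ← h]
    exact Ideal.pow_le_self hn.ne')
  have hrad : ∀ N, I ≤ (Ideal.span (Set.range fun i => (powGen x n i : A) ^ N)).radical := fun N =>
    calc I ≤ I.radical := Ideal.le_radical
      _ = (Ideal.span (Set.range fun i => (x i : A))).radical := by rw [hx]
      _ ≤ _ := radical_span_le_radical_span_pow _ n
      _ ≤ _ := radical_span_le_radical_span_pow _ N
  refine two_le_moduleGrade_of_forall (f := fun i => (powGen x n i : A))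
    (fun i => Ideal.pow_le_self hn.ne' (powGen x n i).2)
    (fun u s hu => eq_zero_of_one_le_moduleGrade (Order.one_le_iff_pos.2 hgrade) (hrad s) hu)
    fun e he => ?_
  obtain ⟨v, hv⟩ := exists_smul_eq_of_forall_pow hJ (fun i => (powGen x n i : A)) e fun r => by
    obtain ⟨v, hv⟩ := exists_of_two_le_gradeAssocGraded (powGen x n) h
      (irrelevantIdeal_le_radical x hx hn) 1 r e fun i j => by
        rw [pow_one, pow_one, he, sub_self]
        exact zero_mem _
    exact ⟨v, by simpa using hv⟩
  exact ⟨v, 0, fun i => by rw [hv, sub_self, smul_zero]⟩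

/-- If `ξ_I(M) ≥ 2`, then the grade is at least `2` beyond the amplitude. -/
theorem two_le_gradeAssocGraded_of_amplitude_lt [IsNoetherianRing A] [Module.Finite A M]
    (hxi : 1 < xiInvariant M x) {n : ℕ} (hn : amplitude M x < (n : ℕ∞)) :
    2 ≤ gradeAssocGraded (I ^ n) M :=
  two_le_gradeAssocGraded (powGen x n)
    (mem_pow_of_amplitude_lt x (zero_lt_one.trans (hxi.trans_le (min_le_left _ _))) hn)
    (exists_of_amplitude_lt x hxi hn)

/-- If `grade(G_{I^n}(A)₊, G_{I^n}(M)) ≥ 2` for some `n ≥ 1`, then `ξ_I(M) ≥ 2`. -/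
theorem one_lt_xiInvariant_of_two_le [IsNoetherianRing A] [IsLocalRing A] [Module.Finite A M]
    (hx : Ideal.span (Set.range fun i => (x i : A)) = I) (hgrade : 0 < moduleGrade I M)
    {n : ℕ} (hn : 0 < n) (h : 2 ≤ gradeAssocGraded (I ^ n) M) : 1 < xiInvariant M x := by
  have h0 : ∀ j : ℤ, j < 0 → lCohomologyDeg M x 0 j = ⊥ :=
    fun j hj => lCohomologyDeg_zero_eq_bot M x hj
  have h1 : ∀ j : ℤ, j < 0 → lCohomologyDeg M x 1 j = ⊥ :=
    fun j hj => lCohomologyDeg_one_eq_bot_of_two_le x hx hn h hj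
  have hne : ∀ i : ℕ, (∀ j : ℤ, j < 0 → lCohomologyDeg M x i j = ⊥) →
      ¬(lCohomologyDeg M x i (-1) ≠ ⊥ ∨
        {j : ℤ | j < 0 ∧ lCohomologyDeg M x i j ≠ ⊥}.Infinite) := by
    rintro i hi (h2 | h2)
    · exact h2 (hi _ neg_one_lt_zero)
    · obtain ⟨j, hj, hj'⟩ := h2.nonempty
      exact hj' (hi j hj)
  have h12 : (1 : ℕ∞) < 2 := Nat.one_lt_ofNat
  refine h12.trans_le (le_min (two_le_moduleGrade_of_two_le x hx hgrade hn h)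
    (le_iInf₂ fun i hi => ?_))
  have hi0 : i ≠ 0 := fun hi0 => by
    subst hi0
    exact hne 0 h0 hi.2
  have hi1 : i ≠ 1 := fun hi1 => by
    subst hi1
    exact hne 1 h1 hi.2
  have h2 : 2 ≤ i := by
    clear hi hne h0 h1 h
    omega
  exact_mod_cast h2

end Comparison

end

theorem corollary3p7 {A : Type*} [CommRing A] [IsNoetherianRing A] [IsLocalRing A]
    (I : Ideal A) (M : Type*) [AddCommGroup M] [Module A M] [Module.Finite A M]
    (hgrade : 0 < moduleGrade I M)
    {m : ℕ} (x : Fin m → I) (hx : Ideal.span (Set.range fun i => (x i : A)) = I) :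
    Xor (∀ n : ℕ, amplitude M x < (n : ℕ∞) → gradeAssocGraded (I ^ n) M = 1)
      (∀ n : ℕ, amplitude M x < (n : ℕ∞) → 2 ≤ gradeAssocGraded (I ^ n) M) := by
  obtain ⟨B, hB⟩ := ENat.ne_top_iff_exists.1 (amplitude_lt_top M x hx).ne
  -- Finiteness of the amplitude makes the two alternatives exclude each other.
  have hB' : amplitude M x < ((B + 1 : ℕ) : ℕ∞) := by
    rw [← hB]
    exact_mod_cast Nat.lt_succ_self B
  by_cases hxi : 1 < xiInvariant M x
  · refine Or.inr ⟨fun n hn => two_le_gradeAssocGraded_of_amplitude_lt x hxi hn, fun h1 => ?_⟩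
    have h2 := two_le_gradeAssocGraded_of_amplitude_lt x hxi hB'
    rw [h1 _ hB'] at h2
    exact absurd h2 (not_le.2 Nat.one_lt_ofNat)
  · have hnot : ∀ n : ℕ, amplitude M x < (n : ℕ∞) → ¬2 ≤ gradeAssocGraded (I ^ n) M :=
      fun n hn h => hxi (one_lt_xiInvariant_of_two_le x hx hgrade
        (Nat.cast_pos.1 (lt_of_le_of_lt zero_le hn : (0 : ℕ∞) < n)) h)
    refine Or.inl ⟨fun n hn => le_antisymm (Order.le_of_lt_add_one ?_)
      (one_le_gradeAssocGraded (powGen x n) (mem_pow_of_amplitude_lt x hgrade hn)),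
      fun h => hnot _ hB' (h _ hB')⟩
    rw [one_add_one_eq_two]
    exact not_le.1 (hnot n hn)
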